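/- Let $K\ge 2$ be a fixed integer, let $\alpha>\beta\ge 1$ and $\kappa_1,\kappa_2>0$ be constants, and let $p=p_n$, $q=q_n$ satisfy $0<q<p\le 1$, $p,q\to 0$ and $p\asymp q$. For $c\ge 1$ let $S_c$ be the set of label assignments $Z\in[K]^n$ with $\frac{n}{cK}\le|\{i:Z_i=k\}|\le\frac{cn}{K}$ for all $k\in[K]$, and let $\Gamma(Z)=\{\sigma\circ Z:\sigma \text{ a permutation of }[K]\}$. The true assignment $Z^*$ belongs to $S_\beta$. The symmetric adjacency matrix $A\in\{0,1\}^{n\times n}$ has zero diagonal and independent entries $A_{ij}$, $i<j$, with $\mathbb P(A_{ij}=1)=p$ if $Z^*_i=Z^*_j$ and $\mathbb P(A_{ij}=1)=q$ otherwise. Let $\Pi(\cdot\mid A)$ be the posterior distribution of $Z$ in the Bayesian model with likelihood $\prod_{i<j}B_{Z_iZ_j}^{A_{ij}}(1-B_{Z_iZ_j})^{1-A_{ij}}$, in which $B$ is a symmetric $K\times K$ matrix, $Z$ has the uniform prior on $S_\alpha$ and, independently of $Z$, the entries $B_{ab}$, $1\le a\le b\le K$, are i.i.d. $\mathrm{Beta}(\kappa_1,\kappa_2)$.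 Put $$I=-2\log\big(\sqrt{pq}+\sqrt{(1-p)(1-q)}\big),\qquad \ell(Z,Z^*)=\frac1n\min_{W\in\Gamma(Z),\,W'\in\Gamma(Z^*)}|\{i:W_i\ne W'_i\}|,$$ and $\bar n=n/2$ if $K=2$, $\bar n=n/(K\beta)$ if $K>2$. Suppose that $$\liminf_{n\to\infty}\frac{\bar nI}{\log n}>1 .$$ Then there are constants $C_3,C_4,C_5>0$ such that for every $n\ge 1$ and every $Z^*\in S_\beta$, with probability at least $1-C_4n^{-C_5}$, $$\log\Pi(Z_0\mid A)\ \ge\ -C_3\,n^2I\cdot\ell(Z_0,Z^*)\qquad\text{for all } Z_0\in S_\alpha\setminus\Gamma(Z^*)$$ simultaneously; in particular $Z_0$ may depend on $A$. -/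

import Mathlib

open Filter Topology MeasureTheory ProbabilityTheory Asymptotics

namespace SBM

/-- A label assignment of `n` nodes to `K` communities. -/
abbrev Labels (n K : ℕ) : Type := Fin n → Fin K

/-- The size `n_k(Z)` of community `k`. -/
def commSize {n K : ℕ} (Z : Labels n K) (k : Fin K) : ℕ :=
  (Finset.univ.filter fun i => Z i = k).card

/-- The assignments all of whose community sizes lie in `[n / (α K), α n / K]`. -/
def feasible (n K : ℕ) (α : ℝ) : Set (Labels n K) :=
  {Z | ∀ k : Fin K, (commSize Z k : ℝ) ∈ Set.Icc ((n : ℝ) / (α * K)) (α * n / K)}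

/-- `Γ(Z)`: all relabellings `σ ∘ Z` of `Z` by permutations `σ` of the labels. -/
def cluster {n K : ℕ} (Z : Labels n K) : Set (Labels n K) :=
  Set.range fun σ : Equiv.Perm (Fin K) => (σ ∘ Z : Labels n K)

/-- The distance between two sets of assignments: the minimal Hamming distance between members. -/
noncomputable def clusterDist {n K : ℕ} (G G' : Set (Labels n K)) : ℕ :=
  sInf {d | ∃ Z ∈ G, ∃ Z' ∈ G', d = hammingDist Z Z'}

/-- The misclassification proportion `ℓ(Z, Z')`. -/
noncomputable def loss {n K : ℕ} (Z Z' : Labels n K) : ℝ :=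
  (clusterDist (cluster Z) (cluster Z') : ℝ) / n

/-- The Rényi divergence of order `1/2` between Bernoulli(`p`) and Bernoulli(`q`). -/
noncomputable def renyiHalf (p q : ℝ) : ℝ :=
  -2 * Real.log (√(p * q) + √((1 - p) * (1 - q)))

/-- The effective sample size. -/
noncomputable def effSize (K : ℕ) (β : ℝ) (n : ℕ) : ℝ :=
  if K = 2 then (n : ℝ) / 2 else (n : ℝ) / (K * β)

/-- The random adjacency matrix `A` on the probability space `(Ω, μ)` follows the homogeneous
stochastic block model with assignment `Z`, within-community probability `p` and between-community probability `q`. -/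
structure IsHomogeneousSBM {Ω : Type*} [MeasurableSpace Ω] (μ : Measure Ω) {n K : ℕ}
    (A : Ω → Matrix (Fin n) (Fin n) ℕ) (Z : Labels n K) (p q : ℝ) : Prop where
  adj : ∀ ω, (A ω).IsAdjMatrix
  measurable : ∀ i j, Measurable fun ω => A ω i j
  prob : ∀ i j, i < j → μ.real {ω | A ω i j = 1} = if Z i = Z j then p else q
  indep : iIndepFun (fun (e : {e : Fin n × Fin n // e.1 < e.2}) ω => A ω e.1.1 e.1.2) μ

/-- The likelihood `p(A | Z, B)`. A symmetric matrix `B` is a function on unordered pairs. -/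
def likelihood {n K : ℕ} (A : Matrix (Fin n) (Fin n) ℕ) (Z : Labels n K)
    (B : Sym2 (Fin K) → ℝ) : ℝ :=
  ∏ e : Fin n × Fin n with e.1 < e.2,
    B s(Z e.1, Z e.2) ^ A e.1 e.2 * (1 - B s(Z e.1, Z e.2)) ^ (1 - A e.1 e.2)

/-- The prior on the connectivity matrix: independent Beta(`κ₁`, `κ₂`) entries `B_{ab}`, `a ≤ b`. -/
noncomputable def connPrior (K : ℕ) (κ₁ κ₂ : ℝ) : Measure (Sym2 (Fin K) → ℝ) :=
  Measure.pi fun _ => betaMeasure κ₁ κ₂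

/-- The likelihood of `Z` with the connectivity matrix integrated out. -/
noncomputable def marginal {n K : ℕ} (κ₁ κ₂ : ℝ) (A : Matrix (Fin n) (Fin n) ℕ)
    (Z : Labels n K) : ℝ :=
  ∫ B, likelihood A Z B ∂(connPrior K κ₁ κ₂)

/-- The posterior probability `Π(Z | A)` under the uniform prior on `feasible n K α`. -/
noncomputable def posterior {n K : ℕ} (α κ₁ κ₂ : ℝ) (A : Matrix (Fin n) (Fin n) ℕ)
    (Z : Labels n K) : ℝ :=
  (feasible n K α).indicator (marginal κ₁ κ₂ A) Z /
    ∑ Z' : Labels n K, (feasible n K α).indicator (marginal κ₁ κ₂ A) Z'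

end SBM

/-! The posterior mass of `Z₀` is a ratio of marginal likelihoods. Both parts are compared with the
likelihood L of the truth, taken at the connectivity matrix `homConn` with entries p and q. Write d
for the number of misclassified nodes, minimised over relabellings.

Numerator. The prior gives polynomially large mass to a small box next to `homConn`, on which the
likelihood drops by at most a factor 2, so the marginal is at least a negative power of n times the
likelihood at `homConn` (`marginal_ge`). The expectation of the likelihood ratio of the truth
against `Z₀` is a product of factors 1 + χ² over at most n·d discrepant edges, with χ² = O(I).
Markov's inequality for one weighted sum over all labellings (`measure_ratioSum_ge`) then gives a
lower bound exp(-O(nI)·d)·L for every `Z₀` at once.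

Denominator. The marginal is at most the likelihood maximised over B. The maximiser is a table of
empirical frequencies, hence lies in a grid of polynomial size (`exists_connGrid_maximizer`). The
square root of a likelihood ratio has expectation at most exp(-separation/2), the separation being a
total squared Hellinger distance. For every B it satisfies a dichotomy (`separation_dichotomy`).
Either half of it exceeds d·log n, and the sum of n^(-d) over labellings is bounded; or it exceeds
n·log K, and the K^n labellings contribute at most 1. The strict inequality in the liminf condition
pays for the losses in the first case. By Markov the denominator is at most L times a power of n
(`measure_sqrtRatioSum_ge`, `sum_marginal_le`).

So the log posterior is at least -D·log n - O(nI)·d. Since log n ≤ nI and d ≥ 1 off the true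
cluster, the polynomial factors are absorbed, and nI·d equals n²I times the loss. -/

namespace SBM

/-! ### Hellinger distance of Bernoulli laws and a two-point inequality -/

/-- The Bhattacharyya affinity of Bernoulli(`x`) and Bernoulli(`y`). -/
noncomputable def affinity (x y : ℝ) : ℝ := √(x * y) + √((1 - x) * (1 - y))

/-- Twice the squared Hellinger distance of Bernoulli(`x`) and Bernoulli(`y`). -/
noncomputable def sqHell (x y : ℝ) : ℝ := (√x - √y) ^ 2 + (√(1 - x) - √(1 - y)) ^ 2

lemma renyiHalf_eq (p q : ℝ) : renyiHalf p q = -2 * Real.log (affinity p q) := rfl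

lemma sqHell_nonneg (x y : ℝ) : 0 ≤ sqHell x y := by unfold sqHell; positivity

lemma affinity_nonneg (x y : ℝ) : 0 ≤ affinity x y := by unfold affinity; positivity

lemma affinity_eq {x y : ℝ} (hx : x ∈ Set.Icc (0 : ℝ) 1) (hy : y ∈ Set.Icc (0 : ℝ) 1) :
    affinity x y = 1 - sqHell x y / 2 := by
  obtain ⟨hx0, hx1⟩ := hx
  obtain ⟨hy0, hy1⟩ := hy
  have h1x : 0 ≤ 1 - x := by linarith
  have h1y : 0 ≤ 1 - y := by linarith
  rw [affinity, sqHell, Real.sqrt_mul hx0, Real.sqrt_mul h1x]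
  nlinarith [Real.sq_sqrt hx0, Real.sq_sqrt hy0, Real.sq_sqrt h1x, Real.sq_sqrt h1y]

lemma affinity_le_exp {x y : ℝ} (hx : x ∈ Set.Icc (0 : ℝ) 1) (hy : y ∈ Set.Icc (0 : ℝ) 1) :
    affinity x y ≤ Real.exp (-(sqHell x y / 2)) := by
  rw [affinity_eq hx hy]
  linarith [Real.add_one_le_exp (-(sqHell x y / 2))]

/-- The minimum over u of the right-hand side is PQ/(P+Q)·(v-w)², attained at the weighted mean; the
hypothesis says Q/(P+Q) ≥ 1-η. With v and w the true values and u a fitted one, no choice of u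
avoids paying for the minority weight P. -/
lemma weighted_sq_ge {P Q u v w η : ℝ} (hP : 0 ≤ P) (hQ : 0 ≤ Q)
    (h : P ≤ η * (P + Q)) :
    (1 - η) * P * (v - w) ^ 2 ≤ P * (u - v) ^ 2 + Q * (u - w) ^ 2 := by
  rcases (add_nonneg hP hQ).eq_or_lt with h0 | h0
  · have : P = 0 := by linarith
    subst this
    nlinarith [mul_nonneg hQ (sq_nonneg (u - w))]
  · have h1 : (P + Q) * (P * (u - v) ^ 2 + Q * (u - w) ^ 2) =
        P * Q * (v - w) ^ 2 + (P * (u - v) + Q * (u - w)) ^ 2 := by ring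
    have h2 : (P + Q) * ((1 - η) * P * (v - w) ^ 2) ≤ P * Q * (v - w) ^ 2 := by
      have : (P + Q) * (1 - η) ≤ Q := by linarith
      nlinarith [mul_le_mul_of_nonneg_right this (mul_nonneg hP (sq_nonneg (v - w)))]
    have h3 : (P + Q) * ((1 - η) * P * (v - w) ^ 2) ≤
        (P + Q) * (P * (u - v) ^ 2 + Q * (u - w) ^ 2) := by
      rw [h1]; nlinarith [sq_nonneg (P * (u - v) + Q * (u - w))]
    exact le_of_mul_le_mul_left h3 h0

lemma weighted_sqHell_ge {P Q η : ℝ} (b x y : ℝ) (hP : 0 ≤ P) (hQ : 0 ≤ Q)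
    (h : P ≤ η * (P + Q)) :
    (1 - η) * P * sqHell x y ≤ P * sqHell b x + Q * sqHell b y := by
  have h1 := weighted_sq_ge (u := √b) (v := √x) (w := √y) hP hQ h
  have h2 := weighted_sq_ge (u := √(1 - b)) (v := √(1 - x)) (w := √(1 - y)) hP hQ h
  unfold sqHell
  nlinarith

lemma sqHell_comm (x y : ℝ) : sqHell x y = sqHell y x := by unfold sqHell; ring

lemma min_mul_sqHell_le {P Q m : ℝ} (b x y : ℝ) (hm : 0 ≤ m) (hP : m ≤ P) (hQ : m ≤ Q) :
    m / 2 * sqHell x y ≤ P * sqHell b x + Q * sqHell b y := by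
  have h1 := weighted_sqHell_ge (P := m) (Q := m) (η := 1 / 2) b x y hm hm (by linarith)
  have h2 := mul_le_mul_of_nonneg_right hP (sqHell_nonneg b x)
  have h3 := mul_le_mul_of_nonneg_right hQ (sqHell_nonneg b y)
  linarith

/-! ### Pairs of nodes, blocks and the separation -/

variable {n K : ℕ}

/-- The edge probability of the pair `(i, j)` in the homogeneous model. -/
def edgeProb (Z : Labels n K) (p q : ℝ) (e : Fin n × Fin n) : ℝ := if Z e.1 = Z e.2 then p else q

/-- The pairs `(i, j)` with `i < j`. -/
def edges (n : ℕ) : Finset (Fin n × Fin n) := Finset.univ.filter fun e => e.1 < e.2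

lemma sum_offDiag_eq (f : Fin n × Fin n → ℝ) (hf : ∀ i j, f (i, j) = f (j, i)) :
    ∑ e : Fin n × Fin n with e.1 ≠ e.2, f e = 2 * ∑ e ∈ edges n, f e := by
  have h1 : (Finset.univ.filter fun e : Fin n × Fin n => e.1 ≠ e.2) =
      edges n ∪ (Finset.univ.filter fun e : Fin n × Fin n => e.2 < e.1) := by
    ext e; simp [edges, lt_or_lt_iff_ne]
  have h2 : ∑ e : Fin n × Fin n with e.2 < e.1, f e = ∑ e ∈ edges n, f e := by
    refine Finset.sum_nbij' Prod.swap Prod.swap ?_ ?_ ?_ ?_ ?_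
    · intro e; simp [edges]
    · intro e; simp [edges]
    · intro e; simp
    · intro e; simp
    · intro e _; exact hf _ _
  rw [h1, Finset.sum_union, h2, two_mul]
  rw [Finset.disjoint_left]
  intro e; simp only [edges, Finset.mem_filter, Finset.mem_univ, true_and, not_lt]
  exact le_of_lt

/-- The ordered pairs of distinct nodes in communities `a` and `b`. -/
def block (Z : Labels n K) (a b : Fin K) : Finset (Fin n × Fin n) :=
  Finset.univ.filter fun e => e.1 ≠ e.2 ∧ Z e.1 = a ∧ Z e.2 = b

lemma sum_offDiag_eq_sum_block (Z : Labels n K) (f : Fin n × Fin n → ℝ) :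
    ∑ e : Fin n × Fin n with e.1 ≠ e.2, f e = ∑ a, ∑ b, ∑ e ∈ block Z a b, f e := by
  rw [← Finset.sum_fiberwise (Finset.univ.filter fun e : Fin n × Fin n => e.1 ≠ e.2)
    (fun e => (Z e.1, Z e.2)), Fintype.sum_prod_type]
  refine Finset.sum_congr rfl fun a _ => Finset.sum_congr rfl fun b _ => ?_
  congr 1
  ext e; simp [block]

lemma sum_block_sqHell (Z Zs : Labels n K) (B : Sym2 (Fin K) → ℝ) (p q : ℝ) (a b : Fin K) :
    ∑ e ∈ block Z a b, sqHell (B s(Z e.1, Z e.2)) (edgeProb Zs p q e) =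
      (((block Z a b).filter fun e => Zs e.1 = Zs e.2).card : ℝ) * sqHell (B s(a, b)) p +
      (((block Z a b).filter fun e => ¬ Zs e.1 = Zs e.2).card : ℝ) * sqHell (B s(a, b)) q := by
  rw [← Finset.sum_filter_add_sum_filter_not (block Z a b) (fun e => Zs e.1 = Zs e.2)]
  congr 1
  · rw [← nsmul_eq_mul, ← Finset.sum_const]
    refine Finset.sum_congr rfl fun e he => ?_
    simp only [block, Finset.mem_filter, Finset.mem_univ, true_and] at he
    simp [edgeProb, he.1.2.1, he.1.2.2, he.2]
  · rw [← nsmul_eq_mul, ← Finset.sum_const]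
    refine Finset.sum_congr rfl fun e he => ?_
    simp only [block, Finset.mem_filter, Finset.mem_univ, true_and] at he
    simp [edgeProb, he.1.2.1, he.1.2.2, he.2]

/-- The total squared Hellinger separation between the edge laws given by `(Z, B)` and the
homogeneous edge laws given by `Zs`. -/
noncomputable def separation (Z Zs : Labels n K) (B : Sym2 (Fin K) → ℝ) (p q : ℝ) : ℝ :=
  ∑ e ∈ edges n, sqHell (B s(Z e.1, Z e.2)) (edgeProb Zs p q e)

lemma two_mul_separation (Z Zs : Labels n K) (B : Sym2 (Fin K) → ℝ) (p q : ℝ) :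
    2 * separation Z Zs B p q =
      ∑ a, ∑ b, ((((block Z a b).filter fun e => Zs e.1 = Zs e.2).card : ℝ) *
          sqHell (B s(a, b)) p +
        (((block Z a b).filter fun e => ¬ Zs e.1 = Zs e.2).card : ℝ) * sqHell (B s(a, b)) q) := by
  rw [separation, ← sum_offDiag_eq, sum_offDiag_eq_sum_block Z]
  · simp_rw [sum_block_sqHell]
  · intro i j
    simp [edgeProb, Sym2.eq_swap, eq_comm]

/-! ### Counting discrepant pairs; the sharp local separation bound -/

/-- The ordered pairs on which the partitions given by `Z` and `Zs` disagree. -/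
def discrepancy (Z Zs : Labels n K) : Finset (Fin n × Fin n) :=
  Finset.univ.filter fun e => e.1 ≠ e.2 ∧ ¬ (Z e.1 = Z e.2 ↔ Zs e.1 = Zs e.2)

/-- The nodes at which two labellings differ. -/
def mismatch (Z Zs : Labels n K) : Finset (Fin n) := Finset.univ.filter fun i => Z i ≠ Zs i

lemma card_mismatch (Z Zs : Labels n K) : (mismatch Z Zs).card = hammingDist Z Zs := rfl

lemma card_discrepancy_le (Z Zs : Labels n K) :
    (discrepancy Z Zs).card ≤ 2 * n * hammingDist Z Zs := by
  have h : discrepancy Z Zs ⊆ (mismatch Z Zs ×ˢ Finset.univ) ∪ (Finset.univ ×ˢ mismatch Z Zs) := by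
    intro e
    simp only [discrepancy, mismatch, Finset.mem_filter, Finset.mem_univ, true_and,
      Finset.mem_union, Finset.mem_product, and_true]
    intro he
    by_contra hc
    push Not at hc
    rw [hc.1, hc.2] at he
    exact he.2 Iff.rfl
  refine (Finset.card_le_card h).trans ((Finset.card_union_le _ _).trans ?_)
  rw [Finset.card_product, Finset.card_product, Finset.card_univ, Fintype.card_fin, card_mismatch]
  exact le_of_eq (by ring)

/-- Pair a mismatched i with a correctly labelled j whose true label is `Z i` or `Zs i`: exactly one
of the two labellings joins i and j. There are at least N minus the number of mismatches such j for
each i, and each pair counts in both orders. -/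
lemma card_discrepancy_ge (Z Zs : Labels n K) (N : ℝ)
    (hN : ∀ a b, a ≠ b → N ≤ commSize Zs a + commSize Zs b) :
    2 * hammingDist Z Zs * (N - hammingDist Z Zs) ≤ (discrepancy Z Zs).card := by
  classical
  set S := (mismatch Z Zs).sigma fun i =>
    (Finset.univ.filter fun j => Zs j = Z i ∨ Zs j = Zs i) \ mismatch Z Zs with hS
  have hScard : hammingDist Z Zs * (N - hammingDist Z Zs) ≤ (S.card : ℝ) := by
    rw [hS, Finset.card_sigma, ← card_mismatch, ← nsmul_eq_mul, ← Finset.sum_const]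
    push_cast
    refine Finset.sum_le_sum fun i hi => ?_
    have hi' : Z i ≠ Zs i := by simpa [mismatch] using hi
    have h1 := hN _ _ hi'
    have h2 : (Finset.univ.filter fun j => Zs j = Z i ∨ Zs j = Zs i).card =
        commSize Zs (Z i) + commSize Zs (Zs i) := by
      rw [Finset.filter_or, Finset.card_union_of_disjoint]
      · rfl
      · rw [Finset.disjoint_filter]
        intro j _ h h'
        exact hi' (h.symm.trans h')
    have h3 := Finset.le_card_sdiff (mismatch Z Zs)
      (Finset.univ.filter fun j => Zs j = Z i ∨ Zs j = Zs i)
    rw [h2] at h3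
    have h4 : ((commSize Zs (Z i) + commSize Zs (Zs i) : ℕ) : ℝ) ≤
      (((Finset.univ.filter fun j => Zs j = Z i ∨ Zs j = Zs i) \ mismatch Z Zs).card : ℝ) +
        (mismatch Z Zs).card := by
      exact_mod_cast Nat.sub_le_iff_le_add.mp h3
    push_cast at h4
    linarith
  have hmem : ∀ x ∈ S, x.1 ≠ x.2 ∧ ¬ (Z x.1 = Z x.2 ↔ Zs x.1 = Zs x.2) ∧
      x.1 ∈ mismatch Z Zs ∧ x.2 ∉ mismatch Z Zs := by
    rintro ⟨i, j⟩ h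
    simp only [hS, Finset.mem_sigma, mismatch, Finset.mem_sdiff, Finset.mem_filter,
      Finset.mem_univ, true_and, not_not, ne_eq] at h ⊢
    obtain ⟨hi, hj, hij⟩ := h
    refine ⟨?_, ?_, hi, hij⟩
    · rintro rfl; exact hi hij
    · rw [hij]
      rcases hj with hj | hj <;> rw [hj]
      · simpa using fun h => hi h.symm
      · simpa using hi
  have h1 : S.image (fun x => ((x.1, x.2) : Fin n × Fin n)) ∪
      S.image (fun x => ((x.2, x.1) : Fin n × Fin n)) ⊆ discrepancy Z Zs := by
    intro e he
    simp only [Finset.mem_union, Finset.mem_image] at he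
    simp only [discrepancy, Finset.mem_filter, Finset.mem_univ, true_and]
    rcases he with ⟨x, hx, rfl⟩ | ⟨x, hx, rfl⟩
    · exact ⟨(hmem x hx).1, (hmem x hx).2.1⟩
    · refine ⟨(hmem x hx).1.symm, ?_⟩
      have := (hmem x hx).2.1
      rwa [eq_comm, eq_comm (a := Zs x.2)]
  have h2 := Finset.card_le_card h1
  rw [Finset.card_union_of_disjoint, Finset.card_image_of_injective, Finset.card_image_of_injective]
    at h2
  · have : ((S.card + S.card : ℕ) : ℝ) ≤ (discrepancy Z Zs).card := by exact_mod_cast h2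
    push_cast at this
    linarith
  · rintro ⟨a, b⟩ ⟨c, d⟩ h; simp_all
  · rintro ⟨a, b⟩ ⟨c, d⟩ h; simp_all
  · rw [Finset.disjoint_left]
    intro e he he'
    simp only [Finset.mem_image] at he he'
    obtain ⟨x, hx, rfl⟩ := he
    obtain ⟨y, hy, hxy⟩ := he'
    have := (hmem x hx).2.2.1
    have h' := (hmem y hy).2.2.2
    rw [Prod.mk.injEq] at hxy
    rw [hxy.1] at h'
    exact h' this

lemma card_block_ge (Z : Labels n K) (a b : Fin K) :
    (commSize Z a : ℝ) * commSize Z b - commSize Z a ≤ (block Z a b).card := by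
  classical
  have h : ((Finset.univ.filter fun i => Z i = a) ×ˢ (Finset.univ.filter fun i => Z i = b)) ⊆
      block Z a b ∪ (Finset.univ.filter fun i => Z i = a).image fun i => (i, i) := by
    intro e he
    simp only [Finset.mem_product, Finset.mem_filter, Finset.mem_univ, true_and] at he
    simp only [block, Finset.mem_union, Finset.mem_filter, Finset.mem_univ, true_and,
      Finset.mem_image]
    by_cases h : e.1 = e.2
    · exact Or.inr ⟨e.1, he.1, by ext <;> simp [h]⟩
    · exact Or.inl ⟨h, he⟩
  have h1 := (Finset.card_le_card h).trans (Finset.card_union_le _ _)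
  have h2 : ((Finset.univ.filter fun i => Z i = a).image fun i => (i, i)).card ≤ commSize Z a :=
    Finset.card_image_le
  rw [Finset.card_product] at h1
  have h3 : commSize Z a * commSize Z b ≤ (block Z a b).card + commSize Z a := by
    unfold commSize at *; omega
  have h4 : ((commSize Z a * commSize Z b : ℕ) : ℝ) ≤ ((block Z a b).card + commSize Z a : ℕ) := by
    exact_mod_cast h3
  push_cast at h4
  linarith

/-- Sharp separation bound near the true labelling. -/
lemma separation_ge_of_small (Z Zs : Labels n K) (B : Sym2 (Fin K) → ℝ) (p q η N : ℝ)
    (hη1 : 0 ≤ η) (hη : η ≤ 1)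
    (hN : ∀ a b, a ≠ b → N ≤ commSize Zs a + commSize Zs b)
    (hblock : ∀ a b, 2 * (n : ℝ) * hammingDist Z Zs ≤
      η * (commSize Z a * commSize Z b - commSize Z a)) :
    (1 - η) * sqHell p q * (hammingDist Z Zs * (N - hammingDist Z Zs)) ≤
      separation Z Zs B p q := by
  have hD : ((discrepancy Z Zs).card : ℝ) =
      ∑ a, ∑ b, ((((block Z a b).filter fun e => ¬ (Z e.1 = Z e.2 ↔ Zs e.1 = Zs e.2)).card : ℕ) : ℝ) := by
    have h1 := sum_offDiag_eq_sum_block Z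
      (fun e => if ¬ (Z e.1 = Z e.2 ↔ Zs e.1 = Zs e.2) then (1 : ℝ) else 0)
    simp only [Finset.sum_ite, Finset.sum_const_zero, add_zero, Finset.sum_const, nsmul_eq_mul,
      mul_one] at h1
    rw [← h1, discrepancy, Finset.filter_filter]
  have hη0 : ∀ a b, ((((block Z a b).filter
      fun e => ¬ (Z e.1 = Z e.2 ↔ Zs e.1 = Zs e.2)).card : ℕ) : ℝ) ≤ 2 * n * hammingDist Z Zs := by
    intro a b
    have : ((block Z a b).filter fun e => ¬ (Z e.1 = Z e.2 ↔ Zs e.1 = Zs e.2)) ⊆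
        discrepancy Z Zs := by
      intro e
      simp only [block, discrepancy, Finset.mem_filter, Finset.mem_univ, true_and]
      tauto
    exact_mod_cast (Finset.card_le_card this).trans (card_discrepancy_le Z Zs)
  have hkey : ∀ a b, (1 - η) * ((((block Z a b).filter
      fun e => ¬ (Z e.1 = Z e.2 ↔ Zs e.1 = Zs e.2)).card : ℕ) : ℝ) * sqHell p q ≤
      (((block Z a b).filter fun e => Zs e.1 = Zs e.2).card : ℝ) * sqHell (B s(a, b)) p +
        (((block Z a b).filter fun e => ¬ Zs e.1 = Zs e.2).card : ℝ) * sqHell (B s(a, b)) q := by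
    intro a b
    have hcard : (((block Z a b).filter fun e => Zs e.1 = Zs e.2).card : ℝ) +
        ((block Z a b).filter fun e => ¬ Zs e.1 = Zs e.2).card = (block Z a b).card := by
      exact_mod_cast Finset.card_filter_add_card_filter_not _
    have hsmall := (hη0 a b).trans (hblock a b)
    have hsmall' := hsmall.trans (mul_le_mul_of_nonneg_left (card_block_ge Z a b) hη1)
    rw [← hcard] at hsmall'
    -- Discrepant pairs are the truly separated ones in a diagonal block and the truly joined ones
    -- off the diagonal. In both cases they are the minority, at most a fraction η of the block.
    by_cases hab : a = b
    · have heq : ((block Z a b).filter fun e => ¬ (Z e.1 = Z e.2 ↔ Zs e.1 = Zs e.2)) =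
          (block Z a b).filter fun e => ¬ Zs e.1 = Zs e.2 := by
        refine Finset.filter_congr fun e he => ?_
        simp only [block, Finset.mem_filter, Finset.mem_univ, true_and] at he
        simp [he.2.1, he.2.2, hab]
      rw [heq] at hsmall' ⊢
      rw [add_comm, sqHell_comm p q]
      exact weighted_sqHell_ge _ _ _ (by positivity) (by positivity) (by linarith)
    · have heq : ((block Z a b).filter fun e => ¬ (Z e.1 = Z e.2 ↔ Zs e.1 = Zs e.2)) =
          (block Z a b).filter fun e => Zs e.1 = Zs e.2 := by
        refine Finset.filter_congr fun e he => ?_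
        simp only [block, Finset.mem_filter, Finset.mem_univ, true_and] at he
        simp [he.2.1, he.2.2, hab]
      rw [heq] at hsmall' ⊢
      exact weighted_sqHell_ge _ _ _ (by positivity) (by positivity) (by linarith)
  have hsum := Finset.sum_le_sum fun a (_ : a ∈ Finset.univ) =>
    Finset.sum_le_sum fun b (_ : b ∈ Finset.univ) => hkey a b
  rw [← two_mul_separation] at hsum
  simp_rw [← Finset.sum_mul, ← Finset.mul_sum] at hsum
  rw [← hD] at hsum
  have h5 := mul_le_mul_of_nonneg_left (card_discrepancy_ge Z Zs N hN)
    (mul_nonneg (sub_nonneg.mpr hη) (sqHell_nonneg p q))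
  linarith

/-! ### Relabellings and the distance between clusterings -/

lemma hammingDist_perm_comp (σ : Equiv.Perm (Fin K)) (Z Z' : Labels n K) :
    hammingDist (σ ∘ Z : Labels n K) (σ ∘ Z') = hammingDist Z Z' :=
  hammingDist_comp (fun _ => σ) fun _ => σ.injective

lemma clusterDist_le (Z Zs : Labels n K) (σ : Equiv.Perm (Fin K)) :
    clusterDist (cluster Z) (cluster Zs) ≤ hammingDist (σ ∘ Z : Labels n K) Zs :=
  Nat.sInf_le ⟨_, ⟨σ, rfl⟩, _, ⟨1, rfl⟩, rfl⟩

lemma exists_clusterDist_eq (Z Zs : Labels n K) :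
    ∃ σ : Equiv.Perm (Fin K),
      clusterDist (cluster Z) (cluster Zs) = hammingDist Z (σ ∘ Zs : Labels n K) := by
  have hne : {d | ∃ W ∈ cluster Z, ∃ W' ∈ cluster Zs, d = hammingDist W W'}.Nonempty :=
    ⟨_, _, ⟨1, rfl⟩, _, ⟨1, rfl⟩, rfl⟩
  obtain ⟨_, ⟨σ, rfl⟩, _, ⟨τ, rfl⟩, h⟩ := Nat.sInf_mem hne
  refine ⟨σ⁻¹ * τ, ?_⟩
  rw [clusterDist, h, ← hammingDist_perm_comp σ Z]
  congr 1
  ext i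
  simp

lemma clusterDist_pos {Z Zs : Labels n K} (h : Z ∉ cluster Zs) :
    1 ≤ clusterDist (cluster Z) (cluster Zs) := by
  obtain ⟨σ, hσ⟩ := exists_clusterDist_eq Z Zs
  rw [hσ, Nat.one_le_iff_ne_zero]
  intro h0
  exact h ⟨σ, (eq_of_hammingDist_eq_zero h0).symm⟩

lemma clusterDist_le_card (Z Zs : Labels n K) : clusterDist (cluster Z) (cluster Zs) ≤ n := by
  obtain ⟨σ, hσ⟩ := exists_clusterDist_eq Z Zs
  rw [hσ]
  simpa using hammingDist_le_card_fintype (x := Z) (y := σ ∘ Zs)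

lemma commSize_perm_comp (σ : Equiv.Perm (Fin K)) (Z : Labels n K) (k : Fin K) :
    commSize (σ ∘ Z : Labels n K) k = commSize Z (σ⁻¹ k) := by
  unfold commSize
  congr 1
  ext i
  simpa using (Equiv.eq_symm_apply σ).symm

lemma feasible_perm_comp {c : ℝ} (σ : Equiv.Perm (Fin K)) {Z : Labels n K}
    (hZ : Z ∈ feasible n K c) : (σ ∘ Z : Labels n K) ∈ feasible n K c := by
  intro k
  rw [commSize_perm_comp]
  exact hZ _

lemma edgeProb_perm_comp (σ : Equiv.Perm (Fin K)) (Z : Labels n K) (p q : ℝ) :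
    edgeProb (σ ∘ Z : Labels n K) p q = edgeProb Z p q := by
  ext e; simp [edgeProb]

lemma separation_perm_comp (σ : Equiv.Perm (Fin K)) (Z Zs : Labels n K)
    (B : Sym2 (Fin K) → ℝ) (p q : ℝ) :
    separation Z (σ ∘ Zs : Labels n K) B p q = separation Z Zs B p q := by
  unfold separation; rw [edgeProb_perm_comp]

lemma sum_commSize (Z : Labels n K) : ∑ k, commSize Z k = n := by
  have := Finset.card_eq_sum_card_fiberwise (f := Z) (s := Finset.univ) (t := Finset.univ)
    (fun _ _ => Finset.mem_univ _)
  simpa [commSize] using this.symm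

/-! ### Separation at arbitrary distance -/

/-- The distance of the clusterings is controlled by the Hamming distance after any map of the
labels, not only after a permutation. -/
lemma clusterDist_le_of_label_map (Z Zs : Labels n K) (τ : Fin K → Fin K) {c : ℝ} (hc : 1 ≤ c)
    (hcK : 1 ≤ K)
    (hZs : ∀ k, (n : ℝ) / (c * K) ≤ commSize Zs k) :
    (clusterDist (cluster Z) (cluster Zs) : ℝ) ≤
      c * K * hammingDist (τ ∘ Z : Labels n K) Zs := by
  have hcK0 : 1 ≤ c * K := by
    have : (1 : ℝ) ≤ K := by exact_mod_cast hcK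
    nlinarith
  by_cases hτ : Function.Surjective τ
  · have hb : Function.Bijective τ := Finite.injective_iff_bijective.mp
      (Finite.injective_iff_surjective.mpr hτ)
    have h1 : (clusterDist (cluster Z) (cluster Zs) : ℝ) ≤
        hammingDist (τ ∘ Z : Labels n K) Zs := by
      exact_mod_cast clusterDist_le Z Zs (Equiv.ofBijective τ hb)
    exact h1.trans (le_mul_of_one_le_left (Nat.cast_nonneg _) hcK0)
  · rw [Function.Surjective] at hτ
    push Not at hτ
    obtain ⟨k, hk⟩ := hτ
    -- A label k missed by τ makes the whole true community k mismatched, which is already a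
    -- constant fraction of all nodes.
    have h1 : commSize Zs k ≤ hammingDist (τ ∘ Z : Labels n K) Zs := by
      refine Finset.card_le_card fun i hi => ?_
      simp only [Finset.mem_filter, Finset.mem_univ, true_and] at hi ⊢
      rw [hi]
      exact hk _
    have h2 : (n : ℝ) / (c * K) ≤ hammingDist (τ ∘ Z : Labels n K) Zs :=
      (hZs k).trans (by exact_mod_cast h1)
    rw [div_le_iff₀ (by linarith)] at h2
    have h3 : (clusterDist (cluster Z) (cluster Zs) : ℝ) ≤ n := by
      exact_mod_cast clusterDist_le_card Z Zs
    linarith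

/-- Separation bound valid at all distances, with a non-sharp constant. -/
lemma separation_ge (Z Zs : Labels n K) (B : Sym2 (Fin K) → ℝ) (p q : ℝ) {α β : ℝ}
    (hK : 1 ≤ K) (hα : 0 < α) (hβ : 1 ≤ β) (hZ : Z ∈ feasible n K α)
    (hZs : Zs ∈ feasible n K β) (hn : 2 * (α * K * K) ≤ n) :
    n / (8 * α * β * K ^ 4) * clusterDist (cluster Z) (cluster Zs) * sqHell p q ≤
      separation Z Zs B p q := by
  classical
  have : NeZero K := ⟨by omega⟩
  have hK0 : (0 : ℝ) < K := by exact_mod_cast hK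
  have hmaj : ∀ a, ∃ k, ∀ l, (Finset.univ.filter fun i => Z i = a ∧ Zs i = l).card ≤
      (Finset.univ.filter fun i => Z i = a ∧ Zs i = k).card := by
    intro a
    obtain ⟨k, -, hk⟩ := Finset.exists_max_image Finset.univ
      (fun l => (Finset.univ.filter fun i => Z i = a ∧ Zs i = l).card)
      ⟨(0 : Fin K), Finset.mem_univ _⟩
    exact ⟨k, fun l => hk l (Finset.mem_univ _)⟩
  -- τ sends each community of `Z` to its most frequent true label. It need not be a permutation,
  -- which is why `clusterDist_le_of_label_map` allows arbitrary maps.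
  choose τ hτ using hmaj
  set M : Fin K → Finset (Fin n) := fun a => Finset.univ.filter fun i => Z i = a ∧ Zs i = τ a with hM
  set M' : Fin K → Finset (Fin n) := fun a => Finset.univ.filter fun i => Z i = a ∧ ¬ Zs i = τ a
    with hM'
  have hsplit : ∀ a, (M a).card + (M' a).card = commSize Z a := by
    intro a
    have := Finset.card_filter_add_card_filter_not (s := Finset.univ.filter fun i => Z i = a)
      (fun i => Zs i = τ a)
    rwa [Finset.filter_filter, Finset.filter_filter] at this
  have hbig : ∀ a, commSize Z a ≤ K * (M a).card := by
    intro a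
    have h1 := Finset.card_eq_sum_card_fiberwise (f := Zs)
      (s := Finset.univ.filter fun i => Z i = a) (t := Finset.univ) (fun _ _ => Finset.mem_univ _)
    rw [commSize, h1]
    calc _ ≤ ∑ _k : Fin K, (M a).card := by
          refine Finset.sum_le_sum fun k _ => ?_
          rw [Finset.filter_filter]
          exact hτ a k
      _ = _ := by simp
  have hham : (hammingDist (τ ∘ Z : Labels n K) Zs : ℝ) = ∑ a, ((M' a).card : ℝ) := by
    have h1 := Finset.card_eq_sum_card_fiberwise (f := Z)
      (s := Finset.univ.filter fun i => (τ ∘ Z) i ≠ Zs i) (t := Finset.univ)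
      (fun _ _ => Finset.mem_univ _)
    rw [hammingDist, h1]
    push_cast
    refine Finset.sum_congr rfl fun a _ => ?_
    congr 2
    ext i
    simp only [hM', Finset.mem_filter, Finset.mem_univ, true_and, Function.comp]
    constructor
    · rintro ⟨h, rfl⟩; exact ⟨rfl, fun h' => h h'.symm⟩
    · rintro ⟨rfl, h⟩; exact ⟨fun h' => h h'.symm, rfl⟩
  have hdiag : ∀ a, n / (4 * α * K ^ 3) * (M' a).card * sqHell p q ≤
      (((block Z a a).filter fun e => Zs e.1 = Zs e.2).card : ℝ) * sqHell (B s(a, a)) p +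
        (((block Z a a).filter fun e => ¬ Zs e.1 = Zs e.2).card : ℝ) * sqHell (B s(a, a)) q := by
    intro a
    have hb : (commSize Z a : ℝ) ≤ K * (M a).card := by exact_mod_cast hbig a
    have hlow : (n : ℝ) / (α * K) ≤ commSize Z a := (hZ a).1
    have hR : (n : ℝ) / (α * K ^ 2) ≤ (M a).card := by
      rw [div_le_iff₀ (by positivity)]
      rw [div_le_iff₀ (by positivity)] at hlow
      nlinarith [mul_le_mul_of_nonneg_right hb (by positivity : 0 ≤ α * (K : ℝ))]
    have hR2 : (2 : ℝ) ≤ (M a).card := by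
      refine le_trans ?_ hR
      rw [le_div_iff₀ (by positivity)]
      linarith
    have hs : ((M a).card : ℝ) + (M' a).card = commSize Z a := by exact_mod_cast hsplit a
    have hP : ((M a).card : ℝ) * (M a).card - (M a).card ≤
        ((block Z a a).filter fun e => Zs e.1 = Zs e.2).card := by
      have h1 : (M a).offDiag ⊆ (block Z a a).filter fun e => Zs e.1 = Zs e.2 := by
        intro e
        simp only [hM, block, Finset.mem_offDiag, Finset.mem_filter, Finset.mem_univ, true_and]
        rintro ⟨⟨h1, h2⟩, ⟨h3, h4⟩, h5⟩
        exact ⟨⟨h5, h1, h3⟩, h2.trans h4.symm⟩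
      have h2 := Finset.card_le_card h1
      rw [Finset.offDiag_card, Nat.sub_le_iff_le_add] at h2
      have : (((M a).card * (M a).card : ℕ) : ℝ) ≤ _ := Nat.cast_le.mpr h2
      push_cast at this
      linarith
    have hQ : ((M a).card : ℝ) * (M' a).card ≤
        ((block Z a a).filter fun e => ¬ Zs e.1 = Zs e.2).card := by
      have h1 : (M a) ×ˢ (M' a) ⊆ (block Z a a).filter fun e => ¬ Zs e.1 = Zs e.2 := by
        intro e
        simp only [hM, hM', block, Finset.mem_product, Finset.mem_filter, Finset.mem_univ, true_and]
        rintro ⟨⟨h1, h2⟩, h3, h4⟩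
        refine ⟨⟨fun h => h4 (h ▸ h2), h1, h3⟩, fun h => h4 (h ▸ h2)⟩
      have h2 := Finset.card_le_card h1
      rw [Finset.card_product] at h2
      exact_mod_cast h2
    set R : ℝ := ((M a).card : ℝ)
    set m : ℝ := ((M' a).card : ℝ)
    have hm0 : 0 ≤ m := Nat.cast_nonneg _
    have hK1 : (1 : ℝ) ≤ K := by exact_mod_cast hK
    -- Diagonal blocks suffice: pairs inside the plurality set have true probability p, pairs
    -- between it and the rest have q, so one value B(a,a) cannot fit both. From m ≤ K·R and R ≥ 2,
    -- both counts R² - R and R·m are at least R·m/(2K).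
    have hmin := min_mul_sqHell_le (P := _) (Q := _) (m := R * m / (2 * K)) (B s(a, a)) p q
      (by positivity) (le_trans ?_ hP) (le_trans ?_ hQ)
    · refine le_trans ?_ hmin
      refine mul_le_mul_of_nonneg_right ?_ (sqHell_nonneg _ _)
      have h1 := mul_le_mul_of_nonneg_right hR (by positivity : 0 ≤ m / (4 * K))
      calc _ = n / (α * K ^ 2) * (m / (4 * K)) := by field_simp
        _ ≤ _ := h1
        _ = _ := by field_simp; norm_num
    · rw [div_le_iff₀ (by positivity)]
      have : m ≤ K * R := by linarith
      nlinarith [mul_le_mul_of_nonneg_left this (by linarith : 0 ≤ R),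
        mul_nonneg (mul_nonneg hK0.le (by linarith : 0 ≤ R)) (by linarith : 0 ≤ R - 2)]
    · rw [div_le_iff₀ (by positivity)]
      nlinarith [mul_nonneg (by linarith : 0 ≤ R) hm0]
  have hsum : n / (4 * α * K ^ 3) * hammingDist (τ ∘ Z : Labels n K) Zs * sqHell p q ≤
      2 * separation Z Zs B p q := by
    rw [two_mul_separation, hham, Finset.mul_sum, Finset.sum_mul]
    refine Finset.sum_le_sum fun a _ => (hdiag a).trans ?_
    exact Finset.single_le_sum (f := fun b =>
      (((block Z a b).filter fun e => Zs e.1 = Zs e.2).card : ℝ) * sqHell (B s(a, b)) p +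
        (((block Z a b).filter fun e => ¬ Zs e.1 = Zs e.2).card : ℝ) * sqHell (B s(a, b)) q)
      (fun b _ => add_nonneg (mul_nonneg (Nat.cast_nonneg _) (sqHell_nonneg _ _))
        (mul_nonneg (Nat.cast_nonneg _) (sqHell_nonneg _ _))) (Finset.mem_univ a)
  have hd := clusterDist_le_of_label_map Z Zs τ hβ hK fun k => (hZs k).1
  have h1 := mul_le_mul_of_nonneg_left hd (by positivity : 0 ≤ (n : ℝ) / (8 * α * β * K ^ 4))
  have h2 := mul_le_mul_of_nonneg_right h1 (sqHell_nonneg p q)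
  refine h2.trans ?_
  have h3 : (n : ℝ) / (8 * α * β * K ^ 4) * (β * K * hammingDist (τ ∘ Z : Labels n K) Zs) *
      sqHell p q = n / (4 * α * K ^ 3) * hammingDist (τ ∘ Z : Labels n K) Zs * sqHell p q / 2 := by
    field_simp
    ring
  rw [h3]
  linarith

/-! ### Generating functions of the distance over all labellings -/

lemma sum_pow_hammingDist_le (Zs : Labels n K) {x : ℝ} (hx : 0 ≤ x) :
    ∑ Z : Labels n K, x ^ hammingDist Z Zs ≤ (1 + K * x) ^ n := by
  have h1 : ∀ Z : Labels n K, x ^ hammingDist Z Zs = ∏ i, if Z i = Zs i then 1 else x := by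
    intro Z
    rw [hammingDist, Finset.prod_ite]
    simp
  simp_rw [h1]
  -- The sum over labellings factorises over nodes.
  rw [← Fintype.prod_sum (fun i k => if k = Zs i then (1 : ℝ) else x)]
  calc _ ≤ ∏ _i : Fin n, (1 + K * x) := by
        refine Finset.prod_le_prod (fun i _ => Finset.sum_nonneg fun k _ => ?_) fun i _ => ?_
        · split_ifs <;> simp [hx]
        · calc ∑ k, (if k = Zs i then (1 : ℝ) else x) ≤ ∑ k, ((if k = Zs i then 1 else 0) + x) := by
                refine Finset.sum_le_sum fun k _ => ?_
                split_ifs <;> simp [hx]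
            _ = _ := by simp [Finset.sum_add_distrib]
    _ = _ := by simp

lemma sum_perm_sum_pow_hammingDist_le (Zs : Labels n K) (hn : 1 ≤ n) :
    ∑ σ : Equiv.Perm (Fin K), ∑ Z : Labels n K,
      ((n : ℝ)⁻¹) ^ hammingDist Z (σ ∘ Zs : Labels n K) ≤ K.factorial * Real.exp K := by
  have hn0 : (0 : ℝ) < n := by exact_mod_cast hn
  calc _ ≤ ∑ _σ : Equiv.Perm (Fin K), Real.exp K := by
        refine Finset.sum_le_sum fun σ _ => (sum_pow_hammingDist_le _ (by positivity)).trans ?_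
        have h1 : 1 + K * (n : ℝ)⁻¹ ≤ Real.exp (K * (n : ℝ)⁻¹) := by
          linarith [Real.add_one_le_exp (K * (n : ℝ)⁻¹)]
        calc _ ≤ Real.exp (K * (n : ℝ)⁻¹) ^ n := pow_le_pow_left₀ (by positivity) h1 n
          _ = _ := by rw [← Real.exp_nat_mul]; congr 1; field_simp
    _ = _ := by simp [Fintype.card_perm]

/-- The distance is attained at some relabelling of `Zs`, and the sum over all relabellings contains
that term. This costs only the factor K!. -/
lemma pow_clusterDist_le (Z Zs : Labels n K) {x : ℝ} (hx : 0 ≤ x) :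
    x ^ clusterDist (cluster Z) (cluster Zs) ≤
      ∑ σ : Equiv.Perm (Fin K), x ^ hammingDist Z (σ ∘ Zs : Labels n K) := by
  obtain ⟨σ, hσ⟩ := exists_clusterDist_eq Z Zs
  rw [hσ]
  exact Finset.single_le_sum (f := fun σ : Equiv.Perm (Fin K) =>
    x ^ hammingDist Z (σ ∘ Zs : Labels n K)) (fun _ _ => pow_nonneg hx _) (Finset.mem_univ σ)

lemma sum_pow_clusterDist_le (Zs : Labels n K) (hn : 1 ≤ n) :
    ∑ Z : Labels n K, ((n : ℝ)⁻¹) ^ clusterDist (cluster Z) (cluster Zs) ≤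
      K.factorial * Real.exp K := by
  refine le_trans (Finset.sum_le_sum fun Z _ => pow_clusterDist_le Z Zs (by positivity)) ?_
  rw [Finset.sum_comm]
  exact sum_perm_sum_pow_hammingDist_le Zs hn

/-! ### The likelihood as a product of Bernoulli factors -/

/-- The Bernoulli(`b`) probability of `x ∈ {0, 1}`. -/
def bern (b : ℝ) (x : ℕ) : ℝ := b ^ x * (1 - b) ^ (1 - x)

@[simp] lemma bern_zero (b : ℝ) : bern b 0 = 1 - b := by simp [bern]

@[simp] lemma bern_one (b : ℝ) : bern b 1 = b := by simp [bern]

lemma bern_nonneg {b : ℝ} (hb : b ∈ Set.Icc (0 : ℝ) 1) (x : ℕ) : 0 ≤ bern b x :=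
  mul_nonneg (pow_nonneg hb.1 _) (pow_nonneg (sub_nonneg.mpr hb.2) _)

lemma bern_le_one {b : ℝ} (hb : b ∈ Set.Icc (0 : ℝ) 1) (x : ℕ) : bern b x ≤ 1 :=
  mul_le_one₀ (pow_le_one₀ hb.1 hb.2) (pow_nonneg (sub_nonneg.mpr hb.2) _)
    (pow_le_one₀ (sub_nonneg.mpr hb.2) (by linarith [hb.1]))

lemma bern_pos {b : ℝ} (h0 : 0 < b) (h1 : b < 1) (x : ℕ) : 0 < bern b x :=
  mul_pos (pow_pos h0 _) (pow_pos (sub_pos.mpr h1) _)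

lemma likelihood_eq (A : Matrix (Fin n) (Fin n) ℕ) (Z : Labels n K) (B : Sym2 (Fin K) → ℝ) :
    likelihood A Z B = ∏ e ∈ edges n, bern (B s(Z e.1, Z e.2)) (A e.1 e.2) := rfl

/-- The connectivity matrix of the homogeneous model. -/
def homConn (K : ℕ) (p q : ℝ) (s : Sym2 (Fin K)) : ℝ := if s.IsDiag then p else q

lemma homConn_mk (Z : Labels n K) (p q : ℝ) (e : Fin n × Fin n) :
    homConn K p q s(Z e.1, Z e.2) = edgeProb Z p q e := by
  simp [homConn, edgeProb]

lemma likelihood_homConn (A : Matrix (Fin n) (Fin n) ℕ) (Z : Labels n K) (p q : ℝ) :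
    likelihood A Z (homConn K p q) = ∏ e ∈ edges n, bern (edgeProb Z p q e) (A e.1 e.2) := by
  simp_rw [likelihood_eq, homConn_mk]

lemma edgeProb_mem {s : Set ℝ} (Z : Labels n K) {p q : ℝ} (hp : p ∈ s) (hq : q ∈ s)
    (e : Fin n × Fin n) : edgeProb Z p q e ∈ s := by
  unfold edgeProb; split_ifs <;> assumption

/-! ### Expectations of likelihood ratios under the true model -/

section Expectation

variable {Ω : Type*} [MeasurableSpace Ω] {μ : Measure Ω} [IsProbabilityMeasure μ]
  {A : Ω → Matrix (Fin n) (Fin n) ℕ} {Zs : Labels n K} {p q : ℝ}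

lemma IsHomogeneousSBM.integrable_prod (h : IsHomogeneousSBM μ A Zs p q)
    (f : Fin n × Fin n → ℕ → ℝ) :
    Integrable (fun ω => ∏ e ∈ edges n, f e (A ω e.1 e.2)) μ := by
  refine Integrable.of_bound (C := ∏ e ∈ edges n, (|f e 0| + |f e 1|)) ?_ ?_
  · refine (Finset.measurable_prod _ fun e _ => ?_).aestronglyMeasurable
    exact (measurable_from_nat (f := f e)).comp (h.measurable e.1 e.2)
  · refine ae_of_all _ fun ω => ?_
    rw [Real.norm_eq_abs, Finset.abs_prod]
    refine Finset.prod_le_prod (fun _ _ => abs_nonneg _) fun e _ => ?_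
    rcases (h.adj ω).zero_or_one e.1 e.2 with h0 | h0 <;> rw [h0] <;> simp

lemma IsHomogeneousSBM.integral_comp (h : IsHomogeneousSBM μ A Zs p q)
    (f : ℕ → ℝ) (e : Fin n × Fin n) (he : e.1 < e.2) :
    ∫ ω, f (A ω e.1 e.2) ∂μ =
      edgeProb Zs p q e * f 1 + (1 - edgeProb Zs p q e) * f 0 := by
  have hm : MeasurableSet {ω | A ω e.1 e.2 = 1} := h.measurable e.1 e.2 (measurableSet_singleton 1)
  have h1 : (fun ω => f (A ω e.1 e.2)) =
      fun ω => f 0 + {ω | A ω e.1 e.2 = 1}.indicator (fun _ => f 1 - f 0) ω := by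
    ext ω
    rcases (h.adj ω).zero_or_one e.1 e.2 with h0 | h0 <;> simp [h0, Set.indicator]
  rw [h1, integral_add (integrable_const _) ((integrable_const _).indicator hm),
    integral_indicator_const _ hm, h.prob _ _ he]
  simp only [integral_const, probReal_univ, smul_eq_mul, edgeProb]
  ring

lemma IsHomogeneousSBM.integral_prod (h : IsHomogeneousSBM μ A Zs p q)
    (f : Fin n × Fin n → ℕ → ℝ) :
    ∫ ω, ∏ e ∈ edges n, f e (A ω e.1 e.2) ∂μ =
      ∏ e ∈ edges n, (edgeProb Zs p q e * f e 1 + (1 - edgeProb Zs p q e) * f e 0) := by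
  have hsub : ∀ x : Fin n × Fin n, x ∈ edges n ↔ x.1 < x.2 := by simp [edges]
  have h1 := h.indep.integral_fun_prod_comp (f := fun e => f e.1)
    (fun e => (h.measurable e.1.1 e.1.2).aemeasurable)
    (fun e => (measurable_from_nat (f := f e.1)).aestronglyMeasurable)
  have h2 : ∀ ω, ∏ e ∈ edges n, f e (A ω e.1 e.2) =
      ∏ e : {e : Fin n × Fin n // e.1 < e.2}, f e.1 (A ω e.1.1 e.1.2) := fun ω =>
    Finset.prod_subtype (edges n) hsub fun e => f e (A ω e.1 e.2)
  simp_rw [h2]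
  rw [h1, Finset.prod_subtype (edges n) hsub]
  exact Finset.prod_congr rfl fun e _ => h.integral_comp (f e.1) e.1 e.2

/-- By independence the expectation is a product over edges, and each factor θ√(b/θ) +
(1-θ)√((1-b)/(1-θ)) is the affinity of b and θ. -/
lemma IsHomogeneousSBM.integral_sqrt_ratio (h : IsHomogeneousSBM μ A Zs p q)
    (hp : p ∈ Set.Ioo (0 : ℝ) 1) (hq : q ∈ Set.Ioo (0 : ℝ) 1) (Z : Labels n K)
    {B : Sym2 (Fin K) → ℝ} (hB : ∀ s, B s ∈ Set.Icc (0 : ℝ) 1) :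
    ∫ ω, ∏ e ∈ edges n, (√(bern (B s(Z e.1, Z e.2)) (A ω e.1 e.2)) /
        √(bern (edgeProb Zs p q e) (A ω e.1 e.2))) ∂μ ≤
      Real.exp (-(separation Z Zs B p q / 2)) := by
  rw [h.integral_prod fun e x => √(bern (B s(Z e.1, Z e.2)) x) / √(bern (edgeProb Zs p q e) x)]
  have h1 : ∀ e : Fin n × Fin n,
      edgeProb Zs p q e * (√(bern (B s(Z e.1, Z e.2)) 1) / √(bern (edgeProb Zs p q e) 1)) +
      (1 - edgeProb Zs p q e) * (√(bern (B s(Z e.1, Z e.2)) 0) / √(bern (edgeProb Zs p q e) 0)) =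
      affinity (B s(Z e.1, Z e.2)) (edgeProb Zs p q e) := by
    intro e
    obtain ⟨hθ0, hθ1⟩ := edgeProb_mem Zs hp hq e
    have hθ1' : 0 < 1 - edgeProb Zs p q e := sub_pos.mpr hθ1
    set θ := edgeProb Zs p q e
    set b := B s(Z e.1, Z e.2) with hb
    obtain ⟨hb0, hb1⟩ := hB s(Z e.1, Z e.2)
    have aux : ∀ x y : ℝ, 0 < x → 0 ≤ y → x * (√y / √x) = √(y * x) := by
      intro x y hx hy
      rw [Real.sqrt_mul hy]
      have := Real.mul_self_sqrt hx.le
      have h' : √x ≠ 0 := (Real.sqrt_pos.mpr hx).ne'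
      field_simp
      linear_combination (-√y) * this
    rw [bern_one, bern_one, bern_zero, bern_zero, aux _ _ hθ0 hb0,
      aux _ _ hθ1' (sub_nonneg.mpr hb1), affinity]
  simp_rw [h1]
  rw [separation, Finset.sum_div, ← Finset.sum_neg_distrib, Real.exp_sum]
  exact Finset.prod_le_prod (fun _ _ => affinity_nonneg _ _) fun e _ =>
    affinity_le_exp (hB _) (Set.Ioo_subset_Icc_self (edgeProb_mem Zs hp hq e))

/-- Each edge contributes θ²/θ' + (1-θ)²/(1-θ') = 1 + χ². This is 1 unless the labellings disagree
on whether the endpoints are together, and at most n times the Hamming distance many edges are of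
that kind. -/
lemma IsHomogeneousSBM.integral_ratio (h : IsHomogeneousSBM μ A Zs p q)
    (hp : p ∈ Set.Ioo (0 : ℝ) 1) (hq : q ∈ Set.Ioo (0 : ℝ) 1) (Z : Labels n K) {c : ℝ}
    (hc1 : (p - q) ^ 2 / (q * (1 - q)) ≤ c) (hc2 : (p - q) ^ 2 / (p * (1 - p)) ≤ c) :
    ∫ ω, ∏ e ∈ edges n, (bern (edgeProb Zs p q e) (A ω e.1 e.2) /
        bern (edgeProb Z p q e) (A ω e.1 e.2)) ∂μ ≤
      Real.exp (c * (n * hammingDist Z Zs)) := by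
  rw [h.integral_prod fun e x => bern (edgeProb Zs p q e) x / bern (edgeProb Z p q e) x]
  obtain ⟨hp0, hp1⟩ := hp
  obtain ⟨hq0, hq1⟩ := hq
  have hp1' : 0 < 1 - p := sub_pos.mpr hp1
  have hq1' : 0 < 1 - q := sub_pos.mpr hq1
  have hsum : ∑ e ∈ edges n, (if (Z e.1 = Z e.2 ↔ Zs e.1 = Zs e.2) then 0 else c) ≤
      c * (n * hammingDist Z Zs) := by
    have hc0 : 0 ≤ c := le_trans (by positivity) hc1
    have h2 : 2 * ∑ e ∈ edges n, (if (Z e.1 = Z e.2 ↔ Zs e.1 = Zs e.2) then 0 else c) =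
        (discrepancy Z Zs).card * c := by
      rw [← sum_offDiag_eq, Finset.sum_ite, Finset.filter_filter]
      · simp [discrepancy, Finset.filter_filter]
      · intro i j; simp [eq_comm]
    have h3 : ((discrepancy Z Zs).card : ℝ) ≤ 2 * n * hammingDist Z Zs := by
      exact_mod_cast card_discrepancy_le Z Zs
    nlinarith
  refine le_trans ?_ (Real.exp_le_exp.mpr hsum)
  rw [Real.exp_sum]
  have hpos : ∀ e, edgeProb Zs p q e ∈ Set.Ioo (0 : ℝ) 1 := fun e =>
    edgeProb_mem (s := Set.Ioo (0 : ℝ) 1) Zs ⟨hp0, hp1⟩ ⟨hq0, hq1⟩ e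
  have hpos' : ∀ e, edgeProb Z p q e ∈ Set.Ioo (0 : ℝ) 1 := fun e =>
    edgeProb_mem (s := Set.Ioo (0 : ℝ) 1) Z ⟨hp0, hp1⟩ ⟨hq0, hq1⟩ e
  refine Finset.prod_le_prod (fun e _ => ?_) fun e _ => ?_
  · simp only [bern_one, bern_zero]
    have h1 := (hpos e).1
    have h2 := sub_pos.mpr (hpos e).2
    have h3 := (hpos' e).1
    have h4 := sub_pos.mpr (hpos' e).2
    positivity
  · simp only [bern_one, bern_zero]
    by_cases h1 : Z e.1 = Z e.2 <;> by_cases h2 : Zs e.1 = Zs e.2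
    · simp only [edgeProb, h1, h2, if_true, iff_self, Real.exp_zero]
      refine le_of_eq ?_
      field_simp
      ring
    · simp only [edgeProb, h1, h2, if_true, if_false, iff_false, not_true]
      calc _ = (p - q) ^ 2 / (p * (1 - p)) + 1 := by field_simp; ring
        _ ≤ c + 1 := by linarith
        _ ≤ _ := Real.add_one_le_exp c
    · simp only [edgeProb, h1, h2, if_true, if_false, false_iff, not_true]
      calc _ = (p - q) ^ 2 / (q * (1 - q)) + 1 := by field_simp; ring
        _ ≤ c + 1 := by linarith
        _ ≤ _ := Real.add_one_le_exp c
    · simp only [edgeProb, h1, h2, if_true, if_false, iff_self, Real.exp_zero]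
      refine le_of_eq ?_
      field_simp
      ring

end Expectation

/-! ### Maximum likelihood over the connectivity matrix lies on a polynomial grid -/

lemma pow_mul_pow_le_mle {b : ℝ} (hb : b ∈ Set.Icc (0 : ℝ) 1) (U V : ℕ) :
    b ^ U * (1 - b) ^ V ≤ ((U : ℝ) / (U + V)) ^ U * (1 - (U : ℝ) / (U + V)) ^ V := by
  have h1b : 0 ≤ 1 - b := sub_nonneg.mpr hb.2
  rcases Nat.eq_zero_or_pos U with rfl | hU
  · simpa using pow_le_one₀ h1b (by linarith [hb.1])
  rcases Nat.eq_zero_or_pos V with rfl | hV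
  · have : (U : ℝ) ≠ 0 := by positivity
    simpa [this] using pow_le_one₀ hb.1 hb.2
  have hU0 : (0 : ℝ) < U := by exact_mod_cast hU
  have hV0 : (0 : ℝ) < V := by exact_mod_cast hV
  have hx : 1 - (U : ℝ) / (U + V) = V / (U + V) := by field_simp; ring
  rw [hx]
  -- Gibbs' inequality in multiplicative form: from t/W ≤ exp(t/W - 1), the exponents of the two
  -- factors cancel because the weights U/(U+V) and V/(U+V) match the powers.
  have key : ∀ (t W : ℝ) (m : ℕ), 0 ≤ t → 0 < W → t ^ m ≤ W ^ m * Real.exp (m * (t / W - 1)) := by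
    intro t W m ht hW
    rw [Real.exp_nat_mul, ← mul_pow]
    refine pow_le_pow_left₀ ht ?_ m
    have := Real.add_one_le_exp (t / W - 1)
    calc t = W * (t / W) := by field_simp
      _ ≤ _ := mul_le_mul_of_nonneg_left (by linarith) hW.le
  have h1 := key b (U / (U + V)) U hb.1 (by positivity)
  have h2 := key (1 - b) (V / (U + V)) V h1b (by positivity)
  refine (mul_le_mul h1 h2 (pow_nonneg h1b _) (by positivity)).trans (le_of_eq ?_)
  have h3 : (U : ℝ) * (b / (U / (U + V)) - 1) + V * ((1 - b) / (V / (U + V)) - 1) = 0 := by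
    field_simp; ring
  rw [mul_mul_mul_comm, ← Real.exp_add, h3, Real.exp_zero, mul_one]

/-- The fractions in `[0, 1]` with numerator and denominator at most `n ^ 2`. -/
noncomputable def grid (n : ℕ) : Finset ℝ :=
  ((Finset.range (n ^ 2 + 1) ×ˢ Finset.range (n ^ 2 + 1)).image
    fun k : ℕ × ℕ => (k.1 : ℝ) / k.2).filter fun x => x ∈ Set.Icc (0 : ℝ) 1

/-- The connectivity matrices with entries in the grid. -/
noncomputable def connGrid (n K : ℕ) : Finset (Sym2 (Fin K) → ℝ) :=
  Fintype.piFinset fun _ => grid n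

lemma card_connGrid_le (n K : ℕ) :
    (connGrid n K).card ≤ (n ^ 2 + 1) ^ (2 * Fintype.card (Sym2 (Fin K))) := by
  have h1 : (grid n).card ≤ (n ^ 2 + 1) ^ 2 := by
    refine (Finset.card_filter_le _ _).trans (Finset.card_image_le.trans ?_)
    rw [Finset.card_product, Finset.card_range, ← sq]
  rw [connGrid, Fintype.card_piFinset, Finset.prod_const, Finset.card_univ, pow_mul]
  exact Nat.pow_le_pow_left h1 _

lemma mem_Icc_of_mem_connGrid {B : Sym2 (Fin K) → ℝ} (hB : B ∈ connGrid n K) (s : Sym2 (Fin K)) :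
    B s ∈ Set.Icc (0 : ℝ) 1 := by
  have := Fintype.mem_piFinset.mp hB s
  exact (Finset.mem_filter.mp this).2

lemma likelihood_eq_prod_pow (A : Matrix (Fin n) (Fin n) ℕ) (Z : Labels n K)
    (B : Sym2 (Fin K) → ℝ) :
    likelihood A Z B = ∏ s, (B s ^ (∑ e ∈ edges n with s(Z e.1, Z e.2) = s, A e.1 e.2) *
      (1 - B s) ^ (∑ e ∈ edges n with s(Z e.1, Z e.2) = s, (1 - A e.1 e.2))) := by
  rw [likelihood_eq, ← Finset.prod_fiberwise (edges n) (fun e => s(Z e.1, Z e.2))]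
  refine Finset.prod_congr rfl fun s _ => ?_
  rw [← Finset.prod_pow_eq_pow_sum, ← Finset.prod_pow_eq_pow_sum, ← Finset.prod_mul_distrib]
  refine Finset.prod_congr rfl fun e he => ?_
  rw [(Finset.mem_filter.mp he).2, bern]

lemma exists_connGrid_maximizer {A : Matrix (Fin n) (Fin n) ℕ} (hA : A.IsAdjMatrix)
    (Z : Labels n K) :
    ∃ B₀ ∈ connGrid n K, ∀ B : Sym2 (Fin K) → ℝ, (∀ s, B s ∈ Set.Icc (0 : ℝ) 1) →
      likelihood A Z B ≤ likelihood A Z B₀ := by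
  set U : Sym2 (Fin K) → ℕ := fun s => ∑ e ∈ edges n with s(Z e.1, Z e.2) = s, A e.1 e.2 with hU
  set V : Sym2 (Fin K) → ℕ := fun s => ∑ e ∈ edges n with s(Z e.1, Z e.2) = s, (1 - A e.1 e.2)
    with hV
  have hUV : ∀ s, U s + V s ≤ n ^ 2 := by
    intro s
    rw [hU, hV, ← Finset.sum_add_distrib]
    calc _ = ∑ e ∈ edges n with s(Z e.1, Z e.2) = s, 1 := by
          refine Finset.sum_congr rfl fun e _ => ?_
          rcases hA.zero_or_one e.1 e.2 with h | h <;> simp [h]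
      _ ≤ _ := by
          rw [Finset.sum_const, smul_eq_mul, mul_one]
          refine (Finset.card_le_univ _).trans (le_of_eq ?_)
          simp [sq]
  -- The block frequencies. For an empty block this is 0/0 = 0, which belongs to the grid because
  -- denominator 0 is allowed there.
  refine ⟨fun s => (U s : ℝ) / (U s + V s), ?_, ?_⟩
  · refine Fintype.mem_piFinset.mpr fun s => ?_
    have := hUV s
    refine Finset.mem_filter.mpr ⟨Finset.mem_image.mpr ⟨(U s, U s + V s), ?_, by push_cast; rfl⟩,
      by positivity, div_le_one_of_le₀ (by simp) (by positivity)⟩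
    simp only [Finset.mem_product, Finset.mem_range]
    omega
  · intro B hB
    rw [likelihood_eq_prod_pow, likelihood_eq_prod_pow]
    exact Finset.prod_le_prod (fun s _ => mul_nonneg (pow_nonneg (hB s).1 _)
      (pow_nonneg (sub_nonneg.mpr (hB s).2) _)) fun s _ => pow_mul_pow_le_mle (hB s) _ _

lemma likelihood_nonneg (A : Matrix (Fin n) (Fin n) ℕ) (Z : Labels n K)
    {B : Sym2 (Fin K) → ℝ} (hB : ∀ s, B s ∈ Set.Icc (0 : ℝ) 1) : 0 ≤ likelihood A Z B :=
  Finset.prod_nonneg fun _ _ => bern_nonneg (hB _) _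

lemma likelihood_le_one (A : Matrix (Fin n) (Fin n) ℕ) (Z : Labels n K)
    {B : Sym2 (Fin K) → ℝ} (hB : ∀ s, B s ∈ Set.Icc (0 : ℝ) 1) : likelihood A Z B ≤ 1 :=
  Finset.prod_le_one (fun _ _ => bern_nonneg (hB _) _) fun _ _ => bern_le_one (hB _) _

/-! ### Bounding the marginal likelihood from above and below -/

section Prior

variable {κ₁ κ₂ : ℝ}

lemma isProbabilityMeasure_connPrior (K : ℕ) (h₁ : 0 < κ₁) (h₂ : 0 < κ₂) :
    IsProbabilityMeasure (connPrior K κ₁ κ₂) := by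
  have := isProbabilityMeasureBeta h₁ h₂
  unfold connPrior
  infer_instance

lemma ae_betaMeasure_mem_Icc : ∀ᵐ x ∂(betaMeasure κ₁ κ₂), x ∈ Set.Icc (0 : ℝ) 1 := by
  rw [ae_iff, betaMeasure]
  have hm : MeasurableSet {x : ℝ | ¬ x ∈ Set.Icc (0 : ℝ) 1} := measurableSet_Icc.compl
  rw [withDensity_apply _ hm]
  refine setLIntegral_eq_zero hm fun x hx => ?_
  simp only [Set.mem_ofPred_eq, Set.mem_Icc, not_and_or, not_le] at hx
  rcases hx with hx | hx
  · exact betaPDF_eq_zero_of_nonpos hx.le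
  · exact betaPDF_eq_zero_of_one_le hx.le

lemma ae_connPrior_mem_Icc (K : ℕ) (h₁ : 0 < κ₁) (h₂ : 0 < κ₂) :
    ∀ᵐ B ∂(connPrior K κ₁ κ₂), ∀ s, B s ∈ Set.Icc (0 : ℝ) 1 := by
  have := isProbabilityMeasureBeta h₁ h₂
  rw [ae_all_iff]
  intro s
  exact (measurePreserving_eval (fun _ : Sym2 (Fin K) => betaMeasure κ₁ κ₂)
    s).quasiMeasurePreserving.ae ae_betaMeasure_mem_Icc

lemma measurable_likelihood (A : Matrix (Fin n) (Fin n) ℕ) (Z : Labels n K) :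
    Measurable (likelihood A Z) := by
  unfold likelihood
  fun_prop

lemma integrable_likelihood (A : Matrix (Fin n) (Fin n) ℕ) (Z : Labels n K)
    (h₁ : 0 < κ₁) (h₂ : 0 < κ₂) : Integrable (likelihood A Z) (connPrior K κ₁ κ₂) := by
  have := isProbabilityMeasure_connPrior K h₁ h₂
  refine Integrable.of_bound (C := 1) (measurable_likelihood A Z).aestronglyMeasurable ?_
  filter_upwards [ae_connPrior_mem_Icc K h₁ h₂] with B hB
  rw [Real.norm_of_nonneg (likelihood_nonneg A Z hB)]
  exact likelihood_le_one A Z hB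

lemma marginal_nonneg (A : Matrix (Fin n) (Fin n) ℕ) (Z : Labels n K)
    (h₁ : 0 < κ₁) (h₂ : 0 < κ₂) : 0 ≤ marginal κ₁ κ₂ A Z := by
  refine integral_nonneg_of_ae ?_
  filter_upwards [ae_connPrior_mem_Icc K h₁ h₂] with B hB
  exact likelihood_nonneg A Z hB

/-- Replacing the data-dependent maximiser by a sum over the grid leaves deterministic matrices B,
for which the expectation of the square root can be computed. -/
lemma sqrt_marginal_le {A : Matrix (Fin n) (Fin n) ℕ} (hA : A.IsAdjMatrix) (Z : Labels n K)
    (h₁ : 0 < κ₁) (h₂ : 0 < κ₂) :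
    √(marginal κ₁ κ₂ A Z) ≤ ∑ B ∈ connGrid n K, √(likelihood A Z B) := by
  have := isProbabilityMeasure_connPrior K h₁ h₂
  obtain ⟨B₀, hB₀, hmax⟩ := exists_connGrid_maximizer hA Z
  have h3 : marginal κ₁ κ₂ A Z ≤ likelihood A Z B₀ := by
    have h4 : marginal κ₁ κ₂ A Z ≤ ∫ _B, likelihood A Z B₀ ∂(connPrior K κ₁ κ₂) := by
      refine integral_mono_ae (integrable_likelihood A Z h₁ h₂) (integrable_const _) ?_
      filter_upwards [ae_connPrior_mem_Icc K h₁ h₂] with B hB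
      exact hmax B hB
    simpa using h4
  exact (Real.sqrt_le_sqrt h3).trans (Finset.single_le_sum
    (f := fun B => √(likelihood A Z B)) (fun _ _ => Real.sqrt_nonneg _) hB₀)

/-- Polynomial lower bound for the Beta mass of a short interval to the left of `x`. -/
lemma betaMeasure_Icc_ge {m : ℕ} (h₁ : 0 < κ₁) (h₂ : 0 < κ₂) (hm1 : κ₁ ≤ m + 1)
    (hm2 : κ₂ ≤ m + 1) {x t : ℝ} (hx0 : 0 < x) (hx1 : x ≤ 1 / 2) (ht0 : 0 ≤ t)
    (ht : t ≤ 1 / 2) :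
    (beta κ₁ κ₂)⁻¹ * (x / 2) ^ m * (1 / 2) ^ m * (t * x) ≤
      (betaMeasure κ₁ κ₂).real (Set.Icc ((1 - t) * x) x) := by
  have hpm := isProbabilityMeasureBeta h₁ h₂
  have hb := beta_pos h₁ h₂
  set c := (beta κ₁ κ₂)⁻¹ * (x / 2) ^ m * (1 / 2) ^ m with hc
  have hc0 : 0 ≤ c := by positivity
  have hle : ENNReal.ofReal c * volume (Set.Icc ((1 - t) * x) x) ≤
      betaMeasure κ₁ κ₂ (Set.Icc ((1 - t) * x) x) := by
    rw [betaMeasure, withDensity_apply _ measurableSet_Icc, ← setLIntegral_const]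
    refine setLIntegral_mono' measurableSet_Icc fun y hy => ?_
    have hy0 : x / 2 ≤ y := le_trans (by nlinarith) hy.1
    have hy1 : y ≤ 1 / 2 := hy.2.trans hx1
    have hypos : 0 < y := by linarith
    rw [betaPDF_of_pos_lt_one hypos (by linarith)]
    refine ENNReal.ofReal_le_ofReal ?_
    -- Since y < 1, raising the exponent κ₁ - 1 to the integer m lowers the power; this also covers
    -- κ₁ < 1.
    have e1 : (x / 2) ^ m ≤ y ^ (κ₁ - 1) := by
      calc (x / 2) ^ m ≤ y ^ m := pow_le_pow_left₀ (by linarith) hy0 m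
        _ = y ^ (m : ℝ) := (Real.rpow_natCast y m).symm
        _ ≤ _ := Real.rpow_le_rpow_of_exponent_ge hypos (by linarith) (by linarith)
    have e2 : (1 / 2 : ℝ) ^ m ≤ (1 - y) ^ (κ₂ - 1) := by
      calc (1 / 2 : ℝ) ^ m ≤ (1 - y) ^ m := pow_le_pow_left₀ (by norm_num) (by linarith) m
        _ = (1 - y) ^ (m : ℝ) := (Real.rpow_natCast _ m).symm
        _ ≤ _ := Real.rpow_le_rpow_of_exponent_ge (by linarith) (by linarith) (by linarith)
    rw [hc, one_div (beta κ₁ κ₂)]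
    exact mul_le_mul (mul_le_mul_of_nonneg_left e1 (by positivity)) e2 (by positivity)
      (by positivity)
  rw [Real.volume_Icc, ← ENNReal.ofReal_mul hc0] at hle
  have := ENNReal.toReal_mono (measure_ne_top _ _) hle
  rw [ENNReal.toReal_ofReal (mul_nonneg hc0 (by nlinarith))] at this
  calc _ = c * (x - (1 - t) * x) := by ring
    _ ≤ _ := this

/-- The interval lies to the left of x so that the factor for a non-edge does not decrease and the
factor for an edge loses at most 1 - t. -/
lemma bern_ge_of_mem {x t b : ℝ} (hx1 : x ≤ 1) (ht0 : 0 ≤ t)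
    (hb : b ∈ Set.Icc ((1 - t) * x) x) {a : ℕ} (ha : a = 0 ∨ a = 1) :
    (1 - t) * bern x a ≤ bern b a := by
  rcases ha with rfl | rfl
  · rw [bern_zero, bern_zero]
    nlinarith [hb.2]
  · rw [bern_one, bern_one]
    exact hb.1

/-- The marginal likelihood is at least a polynomial fraction of the likelihood at any fixed
connectivity matrix. -/
lemma marginal_ge {A : Matrix (Fin n) (Fin n) ℕ} (hA : A.IsAdjMatrix) (Z : Labels n K)
    (h₁ : 0 < κ₁) (h₂ : 0 < κ₂) {m : ℕ} (hm1 : κ₁ ≤ m + 1) (hm2 : κ₂ ≤ m + 1)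
    (hn : 2 ≤ n) {B₀ : Sym2 (Fin K) → ℝ} {ε : ℝ} (hε : 0 < ε)
    (hB₀ : ∀ s, B₀ s ∈ Set.Icc ε (1 / 2)) :
    1 / 2 * ((beta κ₁ κ₂)⁻¹ * (ε / 2) ^ m * (1 / 2) ^ m * (ε / n ^ 2)) ^
        Fintype.card (Sym2 (Fin K)) * likelihood A Z B₀ ≤ marginal κ₁ κ₂ A Z := by
  have hpm := isProbabilityMeasureBeta h₁ h₂
  have hpr := isProbabilityMeasure_connPrior K h₁ h₂
  have hb := beta_pos h₁ h₂
  have hn0 : (2 : ℝ) ≤ n := by exact_mod_cast hn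
  set t : ℝ := 1 / n ^ 2 with ht
  have ht0 : 0 ≤ t := by positivity
  have ht1 : t ≤ 1 / 4 := by
    rw [ht]
    exact one_div_le_one_div_of_le (by norm_num) (by nlinarith)
  set S : Set (Sym2 (Fin K) → ℝ) := Set.univ.pi fun s => Set.Icc ((1 - t) * B₀ s) (B₀ s) with hS
  have hSm : MeasurableSet S := MeasurableSet.univ_pi fun s => measurableSet_Icc
  have hB01 : ∀ s, B₀ s ∈ Set.Icc (0 : ℝ) 1 := fun s =>
    ⟨hε.le.trans (hB₀ s).1, (hB₀ s).2.trans (by norm_num)⟩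
  -- There are at most n²/2 edges, so t = 1/n² and Bernoulli's inequality keep the total loss below
  -- a factor 2.
  have hhalf : (1 / 2 : ℝ) ≤ (1 - t) ^ (edges n).card := by
    have hcard : 2 * ((edges n).card : ℝ) ≤ n ^ 2 := by
      have h3 := sum_offDiag_eq (n := n) (fun _ => (1 : ℝ)) fun _ _ => rfl
      simp only [Finset.sum_const, nsmul_eq_mul, mul_one] at h3
      rw [← h3]
      have h4 := Finset.card_le_univ (Finset.univ.filter fun e : Fin n × Fin n => e.1 ≠ e.2)
      simp only [Fintype.card_prod, Fintype.card_fin] at h4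
      rw [sq]
      exact_mod_cast h4
    have h5 := one_add_mul_le_pow (a := -t) (by linarith) (edges n).card
    have h6 : ((edges n).card : ℝ) * t ≤ 1 / 2 := by
      rw [ht, mul_one_div, div_le_iff₀ (by positivity)]
      linarith
    rw [sub_eq_add_neg]
    linarith
  have hlik : ∀ B ∈ S, 1 / 2 * likelihood A Z B₀ ≤ likelihood A Z B := by
    intro B hB
    calc 1 / 2 * likelihood A Z B₀ ≤ (1 - t) ^ (edges n).card * likelihood A Z B₀ :=
          mul_le_mul_of_nonneg_right hhalf (likelihood_nonneg A Z hB01)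
      _ = ∏ e ∈ edges n, ((1 - t) * bern (B₀ s(Z e.1, Z e.2)) (A e.1 e.2)) := by
          rw [Finset.prod_mul_distrib, Finset.prod_const, likelihood_eq]
      _ ≤ _ := by
          rw [likelihood_eq]
          refine Finset.prod_le_prod (fun e _ => mul_nonneg (by linarith) (bern_nonneg (hB01 _) _))
            fun e _ => ?_
          exact bern_ge_of_mem (hB01 _).2 ht0 (hB _ (Set.mem_univ _))
            (hA.zero_or_one _ _)
  have hmass : ((beta κ₁ κ₂)⁻¹ * (ε / 2) ^ m * (1 / 2) ^ m * (ε / n ^ 2)) ^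
      Fintype.card (Sym2 (Fin K)) ≤ (connPrior K κ₁ κ₂).real S := by
    rw [connPrior, measureReal_def, hS, Measure.pi_pi, ENNReal.toReal_prod, ← Finset.card_univ,
      ← Finset.prod_const]
    refine Finset.prod_le_prod (fun _ _ => by positivity) fun s _ => ?_
    refine le_trans ?_ (betaMeasure_Icc_ge h₁ h₂ hm1 hm2 (hε.trans_le (hB₀ s).1) (hB₀ s).2 ht0
      (by linarith))
    have hεs := (hB₀ s).1
    have hs0 : 0 ≤ B₀ s := (hB01 s).1
    calc _ = (beta κ₁ κ₂)⁻¹ * (ε / 2) ^ m * (1 / 2) ^ m * (t * ε) := by rw [ht]; ring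
      _ ≤ _ := by gcongr
  calc _ = ((beta κ₁ κ₂)⁻¹ * (ε / 2) ^ m * (1 / 2) ^ m * (ε / n ^ 2)) ^
        Fintype.card (Sym2 (Fin K)) * (1 / 2 * likelihood A Z B₀) := by ring
    _ ≤ (connPrior K κ₁ κ₂).real S * (1 / 2 * likelihood A Z B₀) :=
        mul_le_mul_of_nonneg_right hmass
          (mul_nonneg (by norm_num) (likelihood_nonneg A Z hB01))
    _ = ∫ _B in S, 1 / 2 * likelihood A Z B₀ ∂(connPrior K κ₁ κ₂) := by
        rw [setIntegral_const, smul_eq_mul]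
    _ ≤ ∫ B in S, likelihood A Z B ∂(connPrior K κ₁ κ₂) := by
        exact setIntegral_mono_on (integrable_const _).integrableOn
          (integrable_likelihood A Z h₁ h₂).integrableOn hSm hlik
    _ ≤ _ := by
        refine setIntegral_le_integral (integrable_likelihood A Z h₁ h₂) ?_
        filter_upwards [ae_connPrior_mem_Icc K h₁ h₂] with B hB
        exact likelihood_nonneg A Z hB

end Prior

/-! ### Comparing the Rényi divergence with Hellinger and χ² quantities -/

section Scalar

variable {p q : ℝ}

lemma affinity_pos (hp : p ∈ Set.Ioo (0 : ℝ) 1) (hq : q ∈ Set.Ioo (0 : ℝ) 1) :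
    0 < affinity p q :=
  add_pos_of_pos_of_nonneg (Real.sqrt_pos.mpr (mul_pos hp.1 hq.1)) (Real.sqrt_nonneg _)

lemma sqHell_eq_exp (hp : p ∈ Set.Ioo (0 : ℝ) 1) (hq : q ∈ Set.Ioo (0 : ℝ) 1) :
    sqHell p q = 2 * (1 - Real.exp (-(renyiHalf p q / 2))) := by
  have h1 := affinity_eq (Set.Ioo_subset_Icc_self hp) (Set.Ioo_subset_Icc_self hq)
  have h2 : -(renyiHalf p q / 2) = Real.log (affinity p q) := by rw [renyiHalf_eq]; ring
  rw [h2, Real.exp_log (affinity_pos hp hq)]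
  linarith

lemma sqHell_le_renyiHalf (hp : p ∈ Set.Ioo (0 : ℝ) 1) (hq : q ∈ Set.Ioo (0 : ℝ) 1) :
    sqHell p q ≤ renyiHalf p q := by
  rw [sqHell_eq_exp hp hq]
  linarith [Real.add_one_le_exp (-(renyiHalf p q / 2))]

lemma renyiHalf_nonneg (hp : p ∈ Set.Ioo (0 : ℝ) 1) (hq : q ∈ Set.Ioo (0 : ℝ) 1) :
    0 ≤ renyiHalf p q := (sqHell_nonneg p q).trans (sqHell_le_renyiHalf hp hq)

lemma sqHell_ge_of_renyiHalf_le (hp : p ∈ Set.Ioo (0 : ℝ) 1) (hq : q ∈ Set.Ioo (0 : ℝ) 1) {η : ℝ}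
    (h : renyiHalf p q ≤ 2 * η) : (1 - η) * renyiHalf p q ≤ sqHell p q := by
  have hI := renyiHalf_nonneg hp hq
  rw [sqHell_eq_exp hp hq]
  set x := renyiHalf p q / 2 with hx
  have hx0 : 0 ≤ x := by positivity
  have h1 : Real.exp (-x) ≤ 1 / (1 + x) := by
    rw [Real.exp_neg, ← one_div]
    exact one_div_le_one_div_of_le (by linarith) (by linarith [Real.add_one_le_exp x])
  have h2 : 1 / (1 + x) ≤ 1 - x + x ^ 2 := by
    rw [div_le_iff₀ (by linarith)]
    nlinarith [pow_nonneg hx0 3]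
  have h3 : renyiHalf p q = 2 * x := by rw [hx]; ring
  rw [h3] at h ⊢
  nlinarith

/-- Used in reverse: since nI is at least log n, p cannot be smaller than order 1/n, so the prior
density near p and q is only polynomially small. -/
lemma renyiHalf_le_four_mul (hp : p ∈ Set.Ioo (0 : ℝ) 1) (hq : q ∈ Set.Ioo (0 : ℝ) 1)
    (hqp : q ≤ p) (h : renyiHalf p q ≤ 1) : renyiHalf p q ≤ 4 * p := by
  have h1 := sqHell_ge_of_renyiHalf_le hp hq (η := 1 / 2) (by linarith)
  have h2 : sqHell p q ≤ 2 * p := by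
    have hp1 : 0 ≤ 1 - p := by linarith [hp.2]
    have hq1 : 0 ≤ 1 - q := by linarith [hq.2]
    have a1 : √q ≤ √p := Real.sqrt_le_sqrt hqp
    have a2 : √(1 - p) ≤ √(1 - q) := Real.sqrt_le_sqrt (by linarith)
    unfold sqHell
    nlinarith [Real.sq_sqrt hp.1.le, Real.sq_sqrt hq.1.le, Real.sq_sqrt hp1, Real.sq_sqrt hq1,
      Real.sqrt_nonneg q, Real.sqrt_nonneg (1 - p), mul_nonneg (Real.sqrt_nonneg q)
      (sub_nonneg.mpr a1), mul_nonneg (Real.sqrt_nonneg (1 - p)) (sub_nonneg.mpr a2), hq.1]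
  linarith

lemma sq_sub_le_renyiHalf (hp : p ∈ Set.Ioo (0 : ℝ) 1) (hq : q ∈ Set.Ioo (0 : ℝ) 1)
    (hqp : q ≤ p) : (p - q) ^ 2 ≤ 4 * p * renyiHalf p q := by
  have h1 : (√p - √q) ^ 2 ≤ renyiHalf p q := by
    refine le_trans ?_ (sqHell_le_renyiHalf hp hq)
    unfold sqHell
    linarith [sq_nonneg (√(1 - p) - √(1 - q))]
  have h2 : p - q = (√p - √q) * (√p + √q) := by
    linear_combination -(Real.sq_sqrt hp.1.le) + Real.sq_sqrt hq.1.le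
  have h3 : (√p + √q) ^ 2 ≤ 4 * p := by
    have a1 : √q ≤ √p := Real.sqrt_le_sqrt hqp
    nlinarith [Real.sq_sqrt hp.1.le, Real.sqrt_nonneg q]
  rw [h2, mul_pow, mul_comm (4 * p)]
  exact mul_le_mul h1 h3 (sq_nonneg _) (renyiHalf_nonneg hp hq)

/-- The numerator is (√p-√q)²(√p+√q)² ≤ 4p·I, and p is comparable with the denominator because p ≤
C·q. This is where comparability of p and q enters the likelihood ratio bound. -/
lemma chiSq_le (hp : p ∈ Set.Ioc (0 : ℝ) (1 / 2)) (hq : 0 < q) (hqp : q ≤ p) {C : ℝ}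
    (hC : 1 ≤ C) (hpq : p ≤ C * q) {x : ℝ} (hx : x = p ∨ x = q) :
    (p - q) ^ 2 / (x * (1 - x)) ≤ 8 * C * renyiHalf p q := by
  have hp' : p ∈ Set.Ioo (0 : ℝ) 1 := ⟨hp.1, by linarith [hp.2]⟩
  have hq' : q ∈ Set.Ioo (0 : ℝ) 1 := ⟨hq, by linarith [hp.2]⟩
  have hI := renyiHalf_nonneg hp' hq'
  have h1 := sq_sub_le_renyiHalf hp' hq' hqp
  have hx0 : 0 < x := by rcases hx with rfl | rfl <;> linarith [hp.1]
  have hx1 : x ≤ 1 / 2 := by rcases hx with rfl | rfl <;> linarith [hp.2]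
  have hxp : p ≤ C * x := by
    rcases hx with rfl | rfl
    · nlinarith
    · exact hpq
  rw [div_le_iff₀ (mul_pos hx0 (by linarith))]
  refine h1.trans ?_
  have h2 : 4 * p ≤ 8 * C * (x * (1 - x)) := by
    have : x ≤ 2 * (x * (1 - x)) := by nlinarith
    nlinarith [mul_le_mul_of_nonneg_left this (by linarith : 0 ≤ C)]
  nlinarith [mul_le_mul_of_nonneg_right h2 hI]

end Scalar

/-! ### The effective sample size and the separation dichotomy -/

section Dichotomy

lemma effSize_le (hK : 2 ≤ K) {β : ℝ} (hβ : 1 ≤ β) (n : ℕ) : effSize K β n ≤ n := by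
  have hn : (0 : ℝ) ≤ n := Nat.cast_nonneg n
  unfold effSize
  split_ifs
  · linarith
  · have : (2 : ℝ) ≤ K := by exact_mod_cast hK
    exact div_le_self hn (by nlinarith)

lemma effSize_ge (hK : 2 ≤ K) {β : ℝ} (hβ : 1 ≤ β) (n : ℕ) : n / (K * β) ≤ effSize K β n := by
  have hn : (0 : ℝ) ≤ n := Nat.cast_nonneg n
  unfold effSize
  split_ifs with h
  · subst h
    exact div_le_div_of_nonneg_left hn (by norm_num) (by push_cast; linarith)
  · exact le_rfl

/-- For K = 2 two distinct communities exhaust all nodes, whatever their sizes; for larger K only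
the lower bound on each size is available. This is the source of the two cases in `effSize`. -/
lemma two_mul_effSize_le {β : ℝ} {Zs : Labels n K} (hZs : Zs ∈ feasible n K β)
    {a b : Fin K} (hab : a ≠ b) : 2 * effSize K β n ≤ commSize Zs a + commSize Zs b := by
  unfold effSize
  split_ifs with h
  · subst h
    have h1 := sum_commSize Zs
    rw [Fin.sum_univ_two] at h1
    have h2 : commSize Zs a + commSize Zs b = n := by
      fin_cases a <;> fin_cases b <;> simp_all [add_comm]
    have : (commSize Zs a : ℝ) + commSize Zs b = n := by exact_mod_cast h2
    rw [this]
    linarith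
  · have h1 := (hZs a).1
    have h2 := (hZs b).1
    rw [mul_comm β] at h1 h2
    linarith

set_option maxHeartbeats 400000 in
/-- Every feasible labelling is separated from the true one either sharply in the distance or by
more than the entropy of all labellings. -/
lemma separation_dichotomy (hK : 2 ≤ K) {α β r η : ℝ} (hβ : 1 ≤ β) (hα : β < α)
    (hr : 1 < r) (hη : η = (1 - 1 / r) / 3) (hn : 2 * (α * K * K) ≤ n)
    (hnlog : 32 * α * β * K ^ 4 * Real.log K * (4 * α ^ 2 * K ^ 2) / η ≤ Real.log n)
    {p q : ℝ} (hp : p ∈ Set.Ioo (0 : ℝ) 1) (hq : q ∈ Set.Ioo (0 : ℝ) 1)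
    (hI : r * Real.log n ≤ effSize K β n * renyiHalf p q) (hIη : renyiHalf p q ≤ 2 * η)
    {Z Zs : Labels n K} (hZ : Z ∈ feasible n K α) (hZs : Zs ∈ feasible n K β)
    (B : Sym2 (Fin K) → ℝ) :
    clusterDist (cluster Z) (cluster Zs) * Real.log n ≤ separation Z Zs B p q / 2 ∨
      n * Real.log K ≤ separation Z Zs B p q / 2 := by
  have hK2 : (2 : ℝ) ≤ K := by exact_mod_cast hK
  have hr' : 1 / r < 1 := (div_lt_one (by linarith)).mpr hr
  have hr0 : 0 < 1 / r := by positivity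
  have hη0 : 0 < η := by rw [hη]; linarith
  have hη1 : η < 1 / 3 := by rw [hη]; linarith
  have hα0 : 1 < α := by linarith
  have hI0 := renyiHalf_nonneg hp hq
  have hn0 : (0 : ℝ) < n := lt_of_lt_of_le (by positivity) hn
  have hn1 : (1 : ℝ) ≤ n := by exact_mod_cast (Nat.cast_pos.mp hn0)
  have hlog0 : 0 ≤ Real.log n := Real.log_nonneg hn1
  have hs := sqHell_ge_of_renyiHalf_le hp hq hIη
  set d := clusterDist (cluster Z) (cluster Zs) with hd
  -- The threshold makes 2nd at most η times n²/(2α²K²), the lower bound for every block size, as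
  -- the sharp bound requires.
  rcases le_total ((d : ℝ)) (η / (4 * α ^ 2 * K ^ 2) * n) with hsmall | hlarge
  · left
    obtain ⟨σ, hσ⟩ := exists_clusterDist_eq Z Zs
    rw [← hd] at hσ
    have hcomm : ∀ a, (n : ℝ) / (α * K) ≤ commSize Z a := fun a => (hZ a).1
    have hmin : ∀ a b, (n : ℝ) ^ 2 / (2 * α ^ 2 * K ^ 2) ≤
        commSize Z a * commSize Z b - commSize Z a := by
      intro a b
      have h1 := hcomm a
      have h2 := hcomm b
      have h3 : 2 ≤ (n : ℝ) / (α * K) := by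
        rw [le_div_iff₀ (by positivity)]
        have : α * K ≤ α * K * K := le_mul_of_one_le_right (by positivity) (by linarith)
        linarith
      have h4 : (n : ℝ) ^ 2 / (2 * α ^ 2 * K ^ 2) = n / (α * K) * (n / (α * K)) / 2 := by
        field_simp
      rw [h4]
      have h5 := mul_le_mul h1 h2 (by linarith) (by linarith)
      nlinarith
    have hsep := separation_ge_of_small Z (σ ∘ Zs : Labels n K) B p q η (2 * effSize K β n)
      hη0.le (by linarith) (fun a b hab => two_mul_effSize_le (feasible_perm_comp σ hZs) hab) (by
        intro a b
        rw [← hσ]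
        refine le_trans ?_ (mul_le_mul_of_nonneg_left (hmin a b) hη0.le)
        calc 2 * (n : ℝ) * d ≤ 2 * n * (η / (4 * α ^ 2 * K ^ 2) * n) := by gcongr
          _ = _ := by field_simp; ring)
    rw [separation_perm_comp, ← hσ] at hsep
    have heff := effSize_ge hK hβ n
    have hdE : (d : ℝ) ≤ η * (2 * effSize K β n) := by
      refine hsmall.trans ?_
      calc η / (4 * α ^ 2 * K ^ 2) * n = η * (n / (4 * α ^ 2 * K ^ 2)) := by ring
        _ ≤ η * (n / (K * β)) := by
            refine mul_le_mul_of_nonneg_left ?_ hη0.le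
            refine div_le_div_of_nonneg_left hn0.le (by positivity) ?_
            have h1 : β ≤ α ^ 2 := by nlinarith
            have h2 : (K : ℝ) ≤ K ^ 2 := by nlinarith
            nlinarith [mul_le_mul h2 h1 (by linarith) (by positivity)]
        _ ≤ η * (2 * effSize K β n) := by
            refine mul_le_mul_of_nonneg_left ?_ hη0.le
            have : 0 ≤ (n : ℝ) / (K * β) := by positivity
            linarith
    have hE0 : 0 ≤ effSize K β n := le_trans (by positivity) heff
    -- Three factors 1 - η are lost: in the block weights, in replacing 2·`effSize` - d by
    -- 2·`effSize`, and in passing from Hellinger to Rényi. The choice of η makes 1 - 3η equal to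
    -- 1/r.
    have hcube : 1 / r ≤ (1 - η) ^ 3 := by
      have : 1 / r = 1 - 3 * η := by rw [hη]; ring
      rw [this]
      nlinarith [pow_nonneg hη0.le 2]
    have h1 : (1 - η) ^ 3 * (d * (effSize K β n * renyiHalf p q)) ≤ separation Z Zs B p q / 2 := by
      have h2 : (1 - η) * (2 * effSize K β n) ≤ 2 * effSize K β n - d := by linarith
      have h3 := mul_le_mul_of_nonneg_left h2 (Nat.cast_nonneg (α := ℝ) d)
      have h4 := mul_le_mul hs h3 (mul_nonneg (Nat.cast_nonneg _)
        (mul_nonneg (by linarith) (by linarith))) (sqHell_nonneg _ _)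
      have h5 := mul_le_mul_of_nonneg_left h4 (by linarith : 0 ≤ 1 - η)
      nlinarith
    have h2 : (d : ℝ) * (r * Real.log n) ≤ d * (effSize K β n * renyiHalf p q) :=
      mul_le_mul_of_nonneg_left hI (Nat.cast_nonneg _)
    have h3 : 0 ≤ (d : ℝ) * (r * Real.log n) := by positivity
    calc (d : ℝ) * Real.log n = 1 / r * (d * (r * Real.log n)) := by field_simp
      _ ≤ (1 - η) ^ 3 * (d * (effSize K β n * renyiHalf p q)) :=
          mul_le_mul hcube h2 h3 (by linarith)
      _ ≤ _ := h1
  -- Now d is of order n and nI is at least log n, so the separation is of order n·log n and beats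
  -- n·log K even with the crude constant.
  · right
    have hsep := separation_ge Z Zs B p q (by omega) (by linarith) hβ hZ hZs hn
    rw [← hd] at hsep
    have hnI : Real.log n ≤ n * renyiHalf p q := by
      have h1 := mul_le_mul_of_nonneg_right (effSize_le hK hβ n) hI0
      nlinarith
    have h1 : Real.log n / 2 ≤ n * sqHell p q := by nlinarith
    rw [div_le_iff₀ hη0] at hnlog
    have h2 : n / (8 * α * β * K ^ 4) * (η / (4 * α ^ 2 * K ^ 2) * n) * sqHell p q ≤
        separation Z Zs B p q := by
      refine le_trans ?_ hsep
      exact mul_le_mul_of_nonneg_right (mul_le_mul_of_nonneg_left hlarge (by positivity))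
        (sqHell_nonneg _ _)
    have h3 : n / (8 * α * β * K ^ 4) * (η / (4 * α ^ 2 * K ^ 2) * n) * sqHell p q =
        n / (8 * α * β * K ^ 4) * (η / (4 * α ^ 2 * K ^ 2)) * (n * sqHell p q) := by ring
    rw [h3] at h2
    have h4 : n / (8 * α * β * K ^ 4) * (η / (4 * α ^ 2 * K ^ 2)) * (Real.log n / 2) ≤
        separation Z Zs B p q :=
      (mul_le_mul_of_nonneg_left h1 (by positivity)).trans h2
    have h5 : n * Real.log K * 2 ≤
        n / (8 * α * β * K ^ 4) * (η / (4 * α ^ 2 * K ^ 2)) * (Real.log n / 2) := by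
      have : n / (8 * α * β * K ^ 4) * (η / (4 * α ^ 2 * K ^ 2)) * (Real.log n / 2) =
          n * (Real.log n * η) / (16 * α * β * K ^ 4 * (4 * α ^ 2 * K ^ 2)) := by
        rw [div_mul_div_comm, div_mul_div_comm]; congr 1 <;> ring
      rw [this, le_div_iff₀ (by positivity)]
      have := mul_le_mul_of_nonneg_left hnlog hn0.le
      linarith
    linarith

end Dichotomy

lemma IsHomogeneousSBM.perm_comp {Ω : Type*} [MeasurableSpace Ω] {μ : Measure Ω}
    {A : Ω → Matrix (Fin n) (Fin n) ℕ} {Zs : Labels n K} {p q : ℝ}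
    (h : IsHomogeneousSBM μ A Zs p q) (σ : Equiv.Perm (Fin K)) :
    IsHomogeneousSBM μ A (σ ∘ Zs : Labels n K) p q where
  adj := h.adj
  measurable := h.measurable
  prob i j hij := by simpa using h.prob i j hij
  indep := h.indep

open Classical in
/-- The assignments in `feasible n K α`, as a finset. -/
noncomputable def feasibleFinset (n K : ℕ) (α : ℝ) : Finset (Labels n K) :=
  Finset.univ.filter fun Z => Z ∈ feasible n K α

@[simp] lemma mem_feasibleFinset {α : ℝ} {Z : Labels n K} :
    Z ∈ feasibleFinset n K α ↔ Z ∈ feasible n K α := by simp [feasibleFinset]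

lemma posterior_of_mem {α κ₁ κ₂ : ℝ} (A : Matrix (Fin n) (Fin n) ℕ) {Z : Labels n K}
    (hZ : Z ∈ feasible n K α) :
    posterior α κ₁ κ₂ A Z = marginal κ₁ κ₂ A Z /
      ∑ Z' ∈ feasibleFinset n K α, marginal κ₁ κ₂ A Z' := by
  classical
  rw [posterior, Set.indicator_of_mem hZ, feasibleFinset, Finset.sum_filter]
  congr 1

/-! ### Deterministic bounds through sums of likelihood ratios -/

section Likelihood

variable {A : Matrix (Fin n) (Fin n) ℕ} {Zs : Labels n K} {p q : ℝ}

lemma likelihood_homConn_pos (A : Matrix (Fin n) (Fin n) ℕ) (Z : Labels n K)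
    (hp : p ∈ Set.Ioo (0 : ℝ) 1) (hq : q ∈ Set.Ioo (0 : ℝ) 1) :
    0 < likelihood A Z (homConn K p q) := by
  rw [likelihood_homConn]
  exact Finset.prod_pos fun e _ => bern_pos (edgeProb_mem Z hp hq e).1 (edgeProb_mem Z hp hq e).2 _

lemma prod_sqrt_ratio_eq (A : Matrix (Fin n) (Fin n) ℕ) (Z Zs : Labels n K)
    (hp : p ∈ Set.Ioo (0 : ℝ) 1) (hq : q ∈ Set.Ioo (0 : ℝ) 1)
    {B : Sym2 (Fin K) → ℝ} (hB : ∀ s, B s ∈ Set.Icc (0 : ℝ) 1) :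
    ∏ e ∈ edges n, (√(bern (B s(Z e.1, Z e.2)) (A e.1 e.2)) /
      √(bern (edgeProb Zs p q e) (A e.1 e.2))) =
      √(likelihood A Z B) / √(likelihood A Zs (homConn K p q)) := by
  rw [Finset.prod_div_distrib, likelihood_homConn, likelihood_eq, Real.sqrt_prod, Real.sqrt_prod]
  · exact fun e _ => (bern_nonneg (Set.Ioo_subset_Icc_self (edgeProb_mem Zs hp hq e)) _)
  · exact fun e _ => (bern_nonneg (hB _) _)

lemma prod_ratio_eq (A : Matrix (Fin n) (Fin n) ℕ) (Z Zs : Labels n K) :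
    ∏ e ∈ edges n, (bern (edgeProb Zs p q e) (A e.1 e.2) /
      bern (edgeProb Z p q e) (A e.1 e.2)) =
      likelihood A Zs (homConn K p q) / likelihood A Z (homConn K p q) := by
  rw [Finset.prod_div_distrib, likelihood_homConn, likelihood_homConn]

/-- The sum of the square roots of all likelihood ratios over feasible labellings and grid
connectivity matrices. -/
noncomputable def sqrtRatioSum (α p q : ℝ) (Zs : Labels n K) (A : Matrix (Fin n) (Fin n) ℕ) : ℝ :=
  ∑ Z ∈ feasibleFinset n K α, ∑ B ∈ connGrid n K,
    √(likelihood A Z B) / √(likelihood A Zs (homConn K p q))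

lemma sqrtRatioSum_nonneg (α p q : ℝ) (Zs : Labels n K) (A : Matrix (Fin n) (Fin n) ℕ) :
    0 ≤ sqrtRatioSum α p q Zs A :=
  Finset.sum_nonneg fun _ _ => Finset.sum_nonneg fun _ _ => by positivity

/-- A sum of squares of nonnegative numbers is at most the square of their sum, so one first-moment
bound on `sqrtRatioSum` controls the whole evidence. -/
lemma sum_marginal_le {α κ₁ κ₂ : ℝ} (hA : A.IsAdjMatrix) (Zs : Labels n K)
    (hp : p ∈ Set.Ioo (0 : ℝ) 1) (hq : q ∈ Set.Ioo (0 : ℝ) 1) (h₁ : 0 < κ₁) (h₂ : 0 < κ₂) :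
    ∑ Z ∈ feasibleFinset n K α, marginal κ₁ κ₂ A Z ≤
      likelihood A Zs (homConn K p q) * sqrtRatioSum α p q Zs A ^ 2 := by
  have hL := likelihood_homConn_pos A Zs hp hq
  set L := likelihood A Zs (homConn K p q)
  have hsq : ∑ Z ∈ feasibleFinset n K α, (∑ B ∈ connGrid n K, √(likelihood A Z B) / √L) ^ 2 ≤
      sqrtRatioSum α p q Zs A ^ 2 :=
    Finset.sum_sq_le_sq_sum_of_nonneg fun Z _ => Finset.sum_nonneg fun _ _ => by positivity
  refine le_trans ?_ (mul_le_mul_of_nonneg_left hsq hL.le)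
  rw [Finset.mul_sum]
  refine Finset.sum_le_sum fun Z _ => ?_
  have h3 := sqrt_marginal_le hA Z h₁ h₂
  have h4 : L * (∑ B ∈ connGrid n K, √(likelihood A Z B) / √L) ^ 2 =
      (∑ B ∈ connGrid n K, √(likelihood A Z B)) ^ 2 := by
    rw [← Finset.sum_div, div_pow, Real.sq_sqrt hL.le]
    field_simp
  rw [h4, ← Real.sq_sqrt (marginal_nonneg A Z h₁ h₂)]
  exact pow_le_pow_left₀ (Real.sqrt_nonneg _) h3 2

open Classical in
/-- The weighted sum of the likelihood ratios of the truth against all other labellings. -/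
noncomputable def ratioSum (c p q : ℝ) (Zs : Labels n K) (A : Matrix (Fin n) (Fin n) ℕ) : ℝ :=
  ∑ Z : Labels n K with Z ∉ cluster Zs,
    Real.exp (-(c * clusterDist (cluster Z) (cluster Zs))) *
      (likelihood A Zs (homConn K p q) / likelihood A Z (homConn K p q))

lemma ratioSum_nonneg (c : ℝ) (Zs : Labels n K) (A : Matrix (Fin n) (Fin n) ℕ)
    (hp : p ∈ Set.Ioo (0 : ℝ) 1) (hq : q ∈ Set.Ioo (0 : ℝ) 1) : 0 ≤ ratioSum c p q Zs A :=
  Finset.sum_nonneg fun Z _ => mul_nonneg (Real.exp_pos _).le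
    (div_nonneg (likelihood_homConn_pos A Zs hp hq).le (likelihood_homConn_pos A Z hp hq).le)

/-- Each term of the nonnegative sum is at most 1. One event thus serves all labellings, and `Z₀`
may be chosen from the data. -/
lemma likelihood_ge_of_ratioSum_le {c : ℝ} (hp : p ∈ Set.Ioo (0 : ℝ) 1)
    (hq : q ∈ Set.Ioo (0 : ℝ) 1) (h : ratioSum c p q Zs A ≤ 1) {Z : Labels n K}
    (hZ : Z ∉ cluster Zs) :
    Real.exp (-(c * clusterDist (cluster Z) (cluster Zs))) *
      likelihood A Zs (homConn K p q) ≤ likelihood A Z (homConn K p q) := by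
  classical
  have h1 := Finset.single_le_sum (s := Finset.univ.filter fun Z : Labels n K => Z ∉ cluster Zs)
    (f := fun Z => Real.exp (-(c * clusterDist (cluster Z) (cluster Zs))) *
      (likelihood A Zs (homConn K p q) / likelihood A Z (homConn K p q)))
    (fun Z _ => mul_nonneg (Real.exp_pos _).le (div_nonneg
      (likelihood_homConn_pos A Zs hp hq).le (likelihood_homConn_pos A Z hp hq).le))
    (Finset.mem_filter.mpr ⟨Finset.mem_univ Z, hZ⟩)
  have h2 := h1.trans (le_trans (le_of_eq (by unfold ratioSum; congr)) h)
  have hL := likelihood_homConn_pos A Z hp hq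
  simp only [← mul_div_assoc] at h2
  rwa [div_le_one hL] at h2

end Likelihood

/-! ### Markov's inequality for the two sums and the posterior bound -/

section Markov

variable {Ω : Type*} [MeasurableSpace Ω] {μ : Measure Ω} [IsProbabilityMeasure μ]
  {A : Ω → Matrix (Fin n) (Fin n) ℕ} {Zs : Labels n K} {p q : ℝ}

lemma sum_exp_neg_separation_le (hK : 1 ≤ K) (hn : 1 ≤ n) {α : ℝ} (B : Sym2 (Fin K) → ℝ)
    (hdich : ∀ Z ∈ feasible n K α,
      clusterDist (cluster Z) (cluster Zs) * Real.log n ≤ separation Z Zs B p q / 2 ∨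
      n * Real.log K ≤ separation Z Zs B p q / 2) :
    ∑ Z ∈ feasibleFinset n K α, Real.exp (-(separation Z Zs B p q / 2)) ≤
      K.factorial * Real.exp K + 1 := by
  have hn0 : (0 : ℝ) < n := by exact_mod_cast hn
  have hK0 : (0 : ℝ) < K := by exact_mod_cast hK
  have aux : ∀ x : ℝ, 0 < x → ∀ m : ℕ, Real.exp (-(m * Real.log x)) = x⁻¹ ^ m := by
    intro x hx m
    rw [← mul_neg, Real.exp_nat_mul, Real.exp_neg, Real.exp_log hx]
  calc _ ≤ ∑ Z ∈ feasibleFinset n K α,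
        (((n : ℝ)⁻¹) ^ clusterDist (cluster Z) (cluster Zs) + ((K : ℝ)⁻¹) ^ n) := by
        refine Finset.sum_le_sum fun Z hZ => ?_
        rw [← aux n hn0, ← aux K hK0]
        rcases hdich Z (mem_feasibleFinset.mp hZ) with h | h
        · have := Real.exp_le_exp.mpr (neg_le_neg h)
          linarith [Real.exp_pos (-(n * Real.log K))]
        · have := Real.exp_le_exp.mpr (neg_le_neg h)
          linarith [Real.exp_pos (-(clusterDist (cluster Z) (cluster Zs) * Real.log n))]
    _ ≤ ∑ Z : Labels n K,
        (((n : ℝ)⁻¹) ^ clusterDist (cluster Z) (cluster Zs) + ((K : ℝ)⁻¹) ^ n) :=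
        Finset.sum_le_sum_of_subset_of_nonneg (Finset.subset_univ _) fun _ _ _ => by positivity
    _ ≤ _ := by
        rw [Finset.sum_add_distrib]
        refine add_le_add (sum_pow_clusterDist_le Zs hn) (le_of_eq ?_)
        rw [Finset.sum_const, Finset.card_univ, Fintype.card_fun, Fintype.card_fin,
          Fintype.card_fin, nsmul_eq_mul]
        push_cast
        rw [← mul_pow, mul_inv_cancel₀ hK0.ne', one_pow]

lemma IsHomogeneousSBM.measure_sqrtRatioSum_ge (h : IsHomogeneousSBM μ A Zs p q)
    (hp : p ∈ Set.Ioo (0 : ℝ) 1) (hq : q ∈ Set.Ioo (0 : ℝ) 1) (hK : 1 ≤ K) (hn : 1 ≤ n) {α : ℝ}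
    (hdich : ∀ Z ∈ feasible n K α, ∀ B,
      clusterDist (cluster Z) (cluster Zs) * Real.log n ≤ separation Z Zs B p q / 2 ∨
      n * Real.log K ≤ separation Z Zs B p q / 2) {M : ℝ} (hM0 : 0 < M)
    (hM : (connGrid n K).card * (K.factorial * Real.exp K + 1) ≤ M) :
    μ.real {ω | n * M ≤ sqrtRatioSum α p q Zs (A ω)} ≤ 1 / n := by
  have hn0 : (0 : ℝ) < n := by exact_mod_cast hn
  set f : Labels n K → (Sym2 (Fin K) → ℝ) → Ω → ℝ := fun Z B ω =>
    ∏ e ∈ edges n, (√(bern (B s(Z e.1, Z e.2)) (A ω e.1 e.2)) /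
      √(bern (edgeProb Zs p q e) (A ω e.1 e.2))) with hf
  have hfi : ∀ Z B, Integrable (f Z B) μ := fun Z B => h.integrable_prod fun e x =>
    √(bern (B s(Z e.1, Z e.2)) x) / √(bern (edgeProb Zs p q e) x)
  have hX : (fun ω => sqrtRatioSum α p q Zs (A ω)) =
      fun ω => ∑ Z ∈ feasibleFinset n K α, ∑ B ∈ connGrid n K, f Z B ω := by
    ext ω
    refine Finset.sum_congr rfl fun Z _ => Finset.sum_congr rfl fun B hB => ?_
    exact (prod_sqrt_ratio_eq (A ω) Z Zs hp hq (mem_Icc_of_mem_connGrid hB)).symm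
  have hint : Integrable (fun ω => sqrtRatioSum α p q Zs (A ω)) μ := by
    rw [hX]
    exact integrable_finsetSum _ fun Z _ => integrable_finsetSum _ fun B _ => hfi Z B
  have hmean : ∫ ω, sqrtRatioSum α p q Zs (A ω) ∂μ ≤ M := by
    rw [hX, integral_finsetSum _ fun Z _ => integrable_finsetSum _ fun B _ => hfi Z B]
    refine le_trans ?_ hM
    calc _ = ∑ Z ∈ feasibleFinset n K α, ∑ B ∈ connGrid n K, ∫ ω, f Z B ω ∂μ :=
          Finset.sum_congr rfl fun Z _ => integral_finsetSum _ fun B _ => hfi Z B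
      _ ≤ ∑ Z ∈ feasibleFinset n K α, ∑ B ∈ connGrid n K,
            Real.exp (-(separation Z Zs B p q / 2)) :=
          Finset.sum_le_sum fun Z _ => Finset.sum_le_sum fun B hB =>
            h.integral_sqrt_ratio hp hq Z (mem_Icc_of_mem_connGrid hB)
      _ = ∑ B ∈ connGrid n K, ∑ Z ∈ feasibleFinset n K α,
            Real.exp (-(separation Z Zs B p q / 2)) := Finset.sum_comm
      _ ≤ ∑ _B ∈ connGrid n K, (K.factorial * Real.exp K + 1) :=
          Finset.sum_le_sum fun B _ =>
            sum_exp_neg_separation_le hK hn B fun Z hZ => hdich Z hZ B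
      _ = _ := by rw [Finset.sum_const, nsmul_eq_mul]
  have hmk := mul_meas_ge_le_integral_of_nonneg
    (ae_of_all _ fun ω => sqrtRatioSum_nonneg α p q Zs (A ω)) hint (n * M)
  rw [le_div_iff₀ hn0]
  have := hmk.trans hmean
  refine le_of_mul_le_mul_right ?_ hM0
  linarith

lemma IsHomogeneousSBM.measure_ratioSum_ge (h : IsHomogeneousSBM μ A Zs p q)
    (hp : p ∈ Set.Ioo (0 : ℝ) 1) (hq : q ∈ Set.Ioo (0 : ℝ) 1) (hn : 1 ≤ n) {c : ℝ}
    (hc1 : (p - q) ^ 2 / (q * (1 - q)) ≤ c) (hc2 : (p - q) ^ 2 / (p * (1 - p)) ≤ c)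
    {c' : ℝ} (hc' : c * n + 2 * Real.log n ≤ c') :
    μ.real {ω | 1 ≤ ratioSum c' p q Zs (A ω)} ≤ K.factorial * Real.exp K / n := by
  classical
  have hn0 : (0 : ℝ) < n := by exact_mod_cast hn
  set f : Labels n K → Ω → ℝ := fun Z ω =>
    ∏ e ∈ edges n, (bern (edgeProb Zs p q e) (A ω e.1 e.2) /
      bern (edgeProb Z p q e) (A ω e.1 e.2)) with hf
  have hfi : ∀ Z, Integrable (f Z) μ := fun Z => h.integrable_prod fun e x =>
    bern (edgeProb Zs p q e) x / bern (edgeProb Z p q e) x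
  have hX : (fun ω => ratioSum c' p q Zs (A ω)) =
      fun ω => ∑ Z : Labels n K with Z ∉ cluster Zs,
        Real.exp (-(c' * clusterDist (cluster Z) (cluster Zs))) * f Z ω := by
    ext ω
    simp only [hf, prod_ratio_eq]
    unfold ratioSum
    congr
  have hint' : ∀ Z : Labels n K, Integrable (fun ω =>
      Real.exp (-(c' * clusterDist (cluster Z) (cluster Zs))) * f Z ω) μ :=
    fun Z => (hfi Z).const_mul _
  have hint : Integrable (fun ω => ratioSum c' p q Zs (A ω)) μ := by
    rw [hX]
    exact integrable_finsetSum _ fun Z _ => hint' Z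
  have hterm : ∀ Z : Labels n K, Z ∉ cluster Zs →
      ∫ ω, Real.exp (-(c' * clusterDist (cluster Z) (cluster Zs))) * f Z ω ∂μ ≤
        (n : ℝ)⁻¹ * ((n : ℝ)⁻¹) ^ clusterDist (cluster Z) (cluster Zs) := by
    intro Z hZ
    have hd := clusterDist_pos hZ
    obtain ⟨σ, hσ⟩ := exists_clusterDist_eq Z Zs
    -- Relabelling the truth leaves the model unchanged, so the Hamming distance in the exponent can
    -- be taken to be the cluster distance.
    have h1 := (h.perm_comp σ).integral_ratio hp hq Z hc1 hc2
    rw [edgeProb_perm_comp, ← hσ] at h1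
    set d := clusterDist (cluster Z) (cluster Zs)
    have hd1 : (1 : ℝ) ≤ d := by exact_mod_cast hd
    have hlog : 0 ≤ Real.log n := Real.log_nonneg (by exact_mod_cast hn)
    rw [integral_const_mul]
    refine (mul_le_mul_of_nonneg_left h1 (Real.exp_pos _).le).trans ?_
    rw [← Real.exp_add]
    have h2 : (n : ℝ)⁻¹ * ((n : ℝ)⁻¹) ^ d = Real.exp (-((d + 1) * Real.log n)) := by
      rw [← pow_succ', ← mul_neg, ← Real.log_inv]
      rw [← Nat.cast_succ, Real.exp_nat_mul, Real.exp_log (by positivity)]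
    rw [h2]
    -- The term 2·log n in c' yields n^(-2d) ≤ n^(-(d+1)) as d ≥ 1: n^(-d) makes the sum over
    -- labellings bounded, and the spare 1/n becomes the probability bound.
    refine Real.exp_le_exp.mpr ?_
    nlinarith [mul_le_mul_of_nonneg_right hc' (by linarith : (0 : ℝ) ≤ d),
      mul_nonneg (by linarith : (0 : ℝ) ≤ d - 1) hlog]
  have hmean : ∫ ω, ratioSum c' p q Zs (A ω) ∂μ ≤ K.factorial * Real.exp K / n := by
    rw [hX, integral_finsetSum _ fun Z _ => hint' Z]
    calc _ ≤ ∑ Z : Labels n K with Z ∉ cluster Zs,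
          (n : ℝ)⁻¹ * ((n : ℝ)⁻¹) ^ clusterDist (cluster Z) (cluster Zs) :=
          Finset.sum_le_sum fun Z hZ => hterm Z (Finset.mem_filter.mp hZ).2
      _ ≤ ∑ Z : Labels n K,
          (n : ℝ)⁻¹ * ((n : ℝ)⁻¹) ^ clusterDist (cluster Z) (cluster Zs) :=
          Finset.sum_le_sum_of_subset_of_nonneg (Finset.subset_univ _) fun _ _ _ => by positivity
      _ ≤ _ := by
          rw [← Finset.mul_sum, div_eq_inv_mul]
          exact mul_le_mul_of_nonneg_left (sum_pow_clusterDist_le Zs hn) (by positivity)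
  have hmk := mul_meas_ge_le_integral_of_nonneg
    (ae_of_all _ fun ω => ratioSum_nonneg c' Zs (A ω) hp hq) hint 1
  rw [one_mul] at hmk
  exact hmk.trans hmean

/-- Lower bound for the posterior, off an event of probability `O(1 / n)`. -/
lemma IsHomogeneousSBM.posterior_ge (h : IsHomogeneousSBM μ A Zs p q)
    (hp : p ∈ Set.Ioo (0 : ℝ) 1) (hq : q ∈ Set.Ioo (0 : ℝ) 1) (hK : 1 ≤ K) (hn : 1 ≤ n)
    {α κ₁ κ₂ : ℝ} (h₁ : 0 < κ₁) (h₂ : 0 < κ₂)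
    (hdich : ∀ Z ∈ feasible n K α, ∀ B,
      clusterDist (cluster Z) (cluster Zs) * Real.log n ≤ separation Z Zs B p q / 2 ∨
      n * Real.log K ≤ separation Z Zs B p q / 2) {M : ℝ} (hM0 : 0 < M)
    (hM : (connGrid n K).card * (K.factorial * Real.exp K + 1) ≤ M)
    {c : ℝ} (hc1 : (p - q) ^ 2 / (q * (1 - q)) ≤ c) (hc2 : (p - q) ^ 2 / (p * (1 - p)) ≤ c)
    {c' : ℝ} (hc' : c * n + 2 * Real.log n ≤ c')
    {a : ℝ} (ha0 : 0 < a) (ha : ∀ ω Z, a * likelihood (A ω) Z (homConn K p q) ≤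
      marginal κ₁ κ₂ (A ω) Z) :
    1 - (1 + K.factorial * Real.exp K) / n ≤
      μ.real {ω | ∀ Z₀ ∈ feasible n K α, Z₀ ∉ cluster Zs →
        a * Real.exp (-(c' * clusterDist (cluster Z₀) (cluster Zs))) / (n * M) ^ 2 ≤
          posterior α κ₁ κ₂ (A ω) Z₀} := by
  have hn0 : (0 : ℝ) < n := by exact_mod_cast hn
  set G := {ω | ∀ Z₀ ∈ feasible n K α, Z₀ ∉ cluster Zs →
        a * Real.exp (-(c' * clusterDist (cluster Z₀) (cluster Zs))) / (n * M) ^ 2 ≤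
          posterior α κ₁ κ₂ (A ω) Z₀} with hG
  set E₁ := {ω | n * M ≤ sqrtRatioSum α p q Zs (A ω)}
  set E₂ := {ω | 1 ≤ ratioSum c' p q Zs (A ω)}
  have hsub : Set.univ ⊆ G ∪ (E₁ ∪ E₂) := by
    intro ω _
    by_cases hω1 : ω ∈ E₁
    · exact Or.inr (Or.inl hω1)
    by_cases hω2 : ω ∈ E₂
    · exact Or.inr (Or.inr hω2)
    refine Or.inl fun Z₀ hZ₀ hZ₀' => ?_
    have hX : sqrtRatioSum α p q Zs (A ω) ≤ n * M := (not_le.mp hω1).le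
    have hY : ratioSum c' p q Zs (A ω) ≤ 1 := (not_le.mp hω2).le
    have hlow := likelihood_ge_of_ratioSum_le hp hq hY hZ₀'
    have hden := sum_marginal_le (α := α) (h.adj ω) Zs hp hq h₁ h₂
    have hL := likelihood_homConn_pos (A ω) Zs hp hq
    have hL0 := likelihood_homConn_pos (A ω) Z₀ hp hq
    rw [posterior_of_mem _ hZ₀]
    set L := likelihood (A ω) Zs (homConn K p q)
    have hden' : ∑ Z' ∈ feasibleFinset n K α, marginal κ₁ κ₂ (A ω) Z' ≤ L * (n * M) ^ 2 :=
      hden.trans (mul_le_mul_of_nonneg_left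
        (pow_le_pow_left₀ (sqrtRatioSum_nonneg _ _ _ _ _) hX 2) hL.le)
    have hmpos : 0 < marginal κ₁ κ₂ (A ω) Z₀ := (mul_pos ha0 hL0).trans_le (ha ω Z₀)
    have hdenpos : 0 < ∑ Z' ∈ feasibleFinset n K α, marginal κ₁ κ₂ (A ω) Z' :=
      hmpos.trans_le (Finset.single_le_sum (fun Z _ => marginal_nonneg (A ω) Z h₁ h₂)
        (mem_feasibleFinset.mpr hZ₀))
    rw [div_le_div_iff₀ (by positivity) hdenpos]
    set w := Real.exp (-(c' * clusterDist (cluster Z₀) (cluster Zs)))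
    calc a * w * _ ≤ a * w * (L * (n * M) ^ 2) :=
          mul_le_mul_of_nonneg_left hden' (mul_nonneg ha0.le (Real.exp_pos _).le)
      _ = a * (w * L) * (n * M) ^ 2 := by ring
      _ ≤ a * likelihood (A ω) Z₀ (homConn K p q) * (n * M) ^ 2 := by gcongr
      _ ≤ _ := mul_le_mul_of_nonneg_right (ha ω Z₀) (by positivity)
  have h3 := measureReal_mono (μ := μ) hsub
  rw [probReal_univ] at h3
  have h4 := (measureReal_union_le (μ := μ) G (E₁ ∪ E₂)).trans
    (add_le_add_right (measureReal_union_le (μ := μ) E₁ E₂) _)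
  have h5 := h.measure_sqrtRatioSum_ge hp hq hK hn hdich hM0 hM
  have h6 := h.measure_ratioSum_ge hp hq hn hc1 hc2 hc'
  have h7 : (1 + K.factorial * Real.exp K) / n = 1 / (n : ℝ) + K.factorial * Real.exp K / n := by
    ring
  rw [h7]
  linarith

end Markov

/-! ### Asymptotics and polynomial bookkeeping -/

lemma tendsto_renyiHalf_zero {p q : ℕ → ℝ} (hp0 : Tendsto p atTop (𝓝 0))
    (hq0 : Tendsto q atTop (𝓝 0)) : Tendsto (fun n => renyiHalf (p n) (q n)) atTop (𝓝 0) := by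
  have h1 : Tendsto (fun n => √(p n * q n) + √((1 - p n) * (1 - q n))) atTop
      (𝓝 (√(0 * 0) + √((1 - 0) * (1 - 0)))) :=
    (hp0.mul hq0).sqrt.add ((hp0.const_sub 1).mul (hq0.const_sub 1)).sqrt
  have h2 := (h1.log (by simp)).const_mul (-2)
  simpa [renyiHalf] using h2

lemma eventually_effSize_mul_renyiHalf_ge {K : ℕ} {β : ℝ} {p q : ℕ → ℝ}
    (hI : 1 < liminf (fun n : ℕ =>
      ((effSize K β n * renyiHalf (p n) (q n) / Real.log n : ℝ) : EReal)) atTop) :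
    ∃ r : ℝ, 1 < r ∧ ∀ᶠ n : ℕ in atTop,
      r * Real.log n ≤ effSize K β n * renyiHalf (p n) (q n) := by
  obtain ⟨r, hr1, hr2⟩ := EReal.lt_iff_exists_real_btwn.mp hI
  refine ⟨r, by exact_mod_cast hr1, ?_⟩
  filter_upwards [eventually_lt_of_lt_liminf hr2, eventually_ge_atTop 2] with n hn hn2
  have hlog : 0 < Real.log n := Real.log_pos (by exact_mod_cast hn2)
  have := EReal.coe_lt_coe_iff.mp hn
  exact ((lt_div_iff₀ hlog).mp this).le

lemma marginal_ge_inv_pow {n K : ℕ} {κ₁ κ₂ : ℝ} (h₁ : 0 < κ₁) (h₂ : 0 < κ₂) {m : ℕ}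
    (hm1 : κ₁ ≤ m + 1) (hm2 : κ₂ ≤ m + 1) (hn : 2 ≤ n) {C : ℝ} (hC : 0 < C)
    (hn' : 2 / ((beta κ₁ κ₂)⁻¹ * (1 / (8 * C)) ^ m * (1 / 2) ^ m * (1 / (4 * C))) ^
      Fintype.card (Sym2 (Fin K)) ≤ n)
    {p q : ℝ} (hp : p ∈ Set.Icc (1 / (4 * C * n)) (1 / 2))
    (hq : q ∈ Set.Icc (1 / (4 * C * n)) (1 / 2))
    {A : Matrix (Fin n) (Fin n) ℕ} (hA : A.IsAdjMatrix) (Z : Labels n K) :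
    ((n : ℝ) ^ ((m + 3) * Fintype.card (Sym2 (Fin K)) + 1))⁻¹ * likelihood A Z (homConn K p q) ≤
      marginal κ₁ κ₂ A Z := by
  have hn0 : (0 : ℝ) < n := by exact_mod_cast (by omega : 0 < n)
  have hb := beta_pos h₁ h₂
  have hB : ∀ s, homConn K p q s ∈ Set.Icc (1 / (4 * C * n)) (1 / 2) := by
    intro s; unfold homConn; split_ifs <;> assumption
  have hB01 : ∀ s, homConn K p q s ∈ Set.Icc (0 : ℝ) 1 := fun s =>
    ⟨le_trans (by positivity) (hB s).1, (hB s).2.trans (by norm_num)⟩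
  refine le_trans ?_ (marginal_ge hA Z h₁ h₂ hm1 hm2 hn (by positivity) hB)
  refine mul_le_mul_of_nonneg_right ?_ (likelihood_nonneg A Z hB01)
  set c := (beta κ₁ κ₂)⁻¹ * (1 / (8 * C)) ^ m * (1 / 2) ^ m * (1 / (4 * C)) with hc
  set s := Fintype.card (Sym2 (Fin K))
  have hc0 : 0 < c := by positivity
  -- With ε = 1/(4Cn), the density contributes n^(-m) and the interval length ε/n² contributes
  -- n^(-3).
  have h3 : (beta κ₁ κ₂)⁻¹ * (1 / (4 * C * n) / 2) ^ m * (1 / 2) ^ m *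
      (1 / (4 * C * n) / n ^ 2) = c / n ^ (m + 3) := by
    have e1 : 1 / (4 * C * n) / 2 = 1 / (8 * C) * (1 / n) := by field_simp; norm_num
    rw [e1, mul_pow, hc, one_div_pow (n : ℝ), pow_add]
    field_simp
  rw [h3, div_pow, ← pow_mul, pow_succ, mul_inv]
  rw [div_le_iff₀ (by positivity)] at hn'
  calc _ ≤ ((n : ℝ) ^ ((m + 3) * s))⁻¹ * (c ^ s / 2) := by
        refine mul_le_mul_of_nonneg_left ?_ (by positivity)
        rw [inv_le_iff_one_le_mul₀ hn0]
        linarith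
    _ = _ := by ring

lemma card_connGrid_mul_le {n K : ℕ} (hn : 2 ≤ n) {x : ℝ} (hx0 : 0 ≤ x) (hx : x ≤ n) :
    (connGrid n K).card * x ≤ (n : ℝ) ^ (6 * Fintype.card (Sym2 (Fin K)) + 1) := by
  have hn2 : (2 : ℝ) ≤ n := by exact_mod_cast hn
  have h1 : ((connGrid n K).card : ℝ) ≤ ((n : ℝ) ^ 2 + 1) ^ (2 * Fintype.card (Sym2 (Fin K))) := by
    exact_mod_cast card_connGrid_le n K
  have h2 : (n : ℝ) ^ 2 + 1 ≤ n ^ 3 := by nlinarith [mul_self_nonneg ((n : ℝ) - 1)]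
  calc _ ≤ ((n : ℝ) ^ 3) ^ (2 * Fintype.card (Sym2 (Fin K))) * n :=
        mul_le_mul (h1.trans (pow_le_pow_left₀ (by positivity) h2 _)) hx hx0 (by positivity)
    _ = _ := by rw [← pow_mul, pow_succ]; ring_nf

end SBM

/-! ### Assembly of the theorem -/

theorem lemma1
    (K : ℕ) (hK : 2 ≤ K)
    (α β κ₁ κ₂ : ℝ) (hβ : 1 ≤ β) (hα : β < α) (hκ₁ : 0 < κ₁) (hκ₂ : 0 < κ₂)
    (p q : ℕ → ℝ) (hq : ∀ n, 0 < q n) (hqp : ∀ n, q n < p n) (hp : ∀ n, p n ≤ 1)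
    (hp0 : Tendsto p atTop (𝓝 0)) (hq0 : Tendsto q atTop (𝓝 0)) (hpq : p =Θ[atTop] q)
    (hI : 1 < liminf (fun n : ℕ =>
      ((SBM.effSize K β n * SBM.renyiHalf (p n) (q n) / Real.log n : ℝ) : EReal)) atTop) :
    ∃ C₃ C₄ C₅ : ℝ, 0 < C₃ ∧ 0 < C₄ ∧ 0 < C₅ ∧
      ∀ n : ℕ, 1 ≤ n → ∀ Zs : SBM.Labels n K, Zs ∈ SBM.feasible n K β →
      ∀ (Ω : Type*) [MeasurableSpace Ω] (μ : Measure Ω) [IsProbabilityMeasure μ]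
        (A : Ω → Matrix (Fin n) (Fin n) ℕ),
        SBM.IsHomogeneousSBM μ A Zs (p n) (q n) →
        1 - C₄ * (n : ℝ) ^ (-C₅) ≤
          μ.real {ω | ∀ Z₀ ∈ SBM.feasible n K α, Z₀ ∉ SBM.cluster Zs →
            Real.log (SBM.posterior α κ₁ κ₂ (A ω) Z₀) ≥
              -C₃ * (n : ℝ) ^ 2 * SBM.renyiHalf (p n) (q n) * SBM.loss Z₀ Zs} := by
  obtain ⟨r, hr, hr'⟩ := SBM.eventually_effSize_mul_renyiHalf_ge hI
  obtain ⟨C₀, hC₀⟩ := hpq.1.bound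
  set C := max C₀ 1 with hC
  have hC1 : 1 ≤ C := le_max_right _ _
  obtain ⟨m, hm⟩ := exists_nat_ge (max κ₁ κ₂)
  have hm1 : κ₁ ≤ m + 1 := by linarith [le_max_left κ₁ κ₂]
  have hm2 : κ₂ ≤ m + 1 := by linarith [le_max_right κ₁ κ₂]
  set η := (1 - 1 / r) / 3 with hη
  have hη0 : 0 < η := by
    have : 1 / r < 1 := (div_lt_one (by linarith)).mpr hr
    rw [hη]; linarith
  set s := Fintype.card (Sym2 (Fin K))
  set Q : ℝ := K.factorial * Real.exp K with hQ
  have hQ0 : 0 < Q := by positivity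
  have hcast : Tendsto (fun n : ℕ => (n : ℝ)) atTop atTop := tendsto_natCast_atTop_atTop
  have hlogT : Tendsto (fun n : ℕ => Real.log n) atTop atTop := Real.tendsto_log_atTop.comp hcast
  have hev : ∀ᶠ n : ℕ in atTop,
      (r * Real.log n ≤ SBM.effSize K β n * SBM.renyiHalf (p n) (q n) ∧
        SBM.renyiHalf (p n) (q n) ≤ 2 * η ∧ SBM.renyiHalf (p n) (q n) ≤ 1) ∧
      (p n ≤ 1 / 2 ∧ p n ≤ C * q n) ∧
      (2 ≤ n ∧ 2 * (α * K * K) ≤ n ∧ Q + 1 ≤ n ∧ 1 ≤ Real.log n ∧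
        32 * α * β * K ^ 4 * Real.log K * (4 * α ^ 2 * K ^ 2) / η ≤ Real.log n ∧
        2 / ((beta κ₁ κ₂)⁻¹ * (1 / (8 * C)) ^ m * (1 / 2) ^ m * (1 / (4 * C))) ^ s ≤ n) := by
    have hIT := SBM.tendsto_renyiHalf_zero hp0 hq0
    refine (hr'.and ((hIT.eventually_le_const (by linarith)).and
      (hIT.eventually_le_const one_pos))).and (((hp0.eventually_le_const (by norm_num)).and ?_).and
      ((eventually_ge_atTop 2).and ((hcast.eventually_ge_atTop _).and
      ((hcast.eventually_ge_atTop _).and ((hlogT.eventually_ge_atTop _).and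
      ((hlogT.eventually_ge_atTop _).and (hcast.eventually_ge_atTop _)))))))
    filter_upwards [hC₀] with n hn
    rw [Real.norm_of_nonneg ((hq n).trans (hqp n)).le, Real.norm_of_nonneg (hq n).le] at hn
    exact hn.trans (mul_le_mul_of_nonneg_right (le_max_left _ _) (hq n).le)
  obtain ⟨N, hN⟩ := eventually_atTop.mp hev
  -- The total power of n lost: (m+3)s + 1 from the prior mass, and the square of n·n^(6s+1) from
  -- the evidence.
  set D : ℕ := (m + 3) * s + 1 + 2 * (6 * s + 2) with hD
  refine ⟨D + (8 * C + 2), max (N : ℝ) (1 + Q), 1, by positivity, lt_max_of_lt_right (by positivity),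
    one_pos, ?_⟩
  intro n hn Zs hZs Ω _ μ _ A h
  have hn0 : (0 : ℝ) < n := by exact_mod_cast hn
  rw [Real.rpow_neg_one]
  -- For n < N the claim is empty: the constant is at least N, so the asserted probability is not
  -- positive.
  rcases lt_or_ge n N with hnN | hnN
  · refine le_trans ?_ measureReal_nonneg
    have h1 : (n : ℝ) ≤ max (N : ℝ) (1 + Q) := le_max_of_le_left (by exact_mod_cast hnN.le)
    rw [sub_nonpos, ← div_eq_mul_inv, one_le_div hn0]
    exact h1
  obtain ⟨⟨hrn, hIη, hI1⟩, ⟨hp2, hpC⟩, hn2, hnα, hnQ, hlog1, hlogη, hnc⟩ := hN n hnN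
  have hpp : 0 < p n := (hq n).trans (hqp n)
  have hp' : p n ∈ Set.Ioo (0 : ℝ) 1 := ⟨hpp, by linarith⟩
  have hq' : q n ∈ Set.Ioo (0 : ℝ) 1 := ⟨hq n, by linarith [hqp n]⟩
  have hI0 := SBM.renyiHalf_nonneg hp' hq'
  have hI4 := SBM.renyiHalf_le_four_mul hp' hq' (hqp n).le hI1
  set I := SBM.renyiHalf (p n) (q n)
  have hnI : Real.log n ≤ n * I := by
    have h1 := mul_le_mul_of_nonneg_right (SBM.effSize_le hK hβ n) hI0
    nlinarith
  -- From 1 ≤ log n ≤ nI ≤ 4np ≤ 4Cnq.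
  have hqlow : 1 / (4 * C * n) ≤ q n := by
    rw [div_le_iff₀ (by positivity)]
    nlinarith [mul_le_mul_of_nonneg_left hpC hn0.le, mul_le_mul_of_nonneg_left hI4 hn0.le]
  have key := h.posterior_ge hp' hq' (by omega) hn hκ₁ hκ₂
    (fun Z hZ B => SBM.separation_dichotomy hK hβ hα hr hη hnα hlogη hp' hq' hrn hIη hZ hZs B)
    (M := (n : ℝ) ^ (6 * s + 1)) (by positivity)
    (SBM.card_connGrid_mul_le hn2 (by positivity) hnQ)
    (SBM.chiSq_le ⟨hpp, hp2⟩ (hq n) (hqp n).le hC1 hpC (Or.inr rfl))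
    (SBM.chiSq_le ⟨hpp, hp2⟩ (hq n) (hqp n).le hC1 hpC (Or.inl rfl))
    (c' := (8 * C + 2) * (n * I)) (by linarith)
    (a := ((n : ℝ) ^ ((m + 3) * s + 1))⁻¹) (by positivity)
    (fun ω Z => SBM.marginal_ge_inv_pow hκ₁ hκ₂ hm1 hm2 hn2 (by linarith) hnc
      ⟨hqlow.trans (hqp n).le, hp2⟩ ⟨hqlow, (hqp n).le.trans hp2⟩ (h.adj ω) Z)
  refine le_trans ?_ (key.trans (measureReal_mono ?_))
  · rw [div_eq_mul_inv]
    have := mul_le_mul_of_nonneg_right (le_max_right (N : ℝ) (1 + Q)) (inv_pos.mpr hn0).le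
    linarith
  · intro ω hω Z₀ hZ₀ hZ₀'
    have h1 := hω Z₀ hZ₀ hZ₀'
    have hd : (1 : ℝ) ≤ SBM.clusterDist (SBM.cluster Z₀) (SBM.cluster Zs) := by
      exact_mod_cast SBM.clusterDist_pos hZ₀'
    rw [SBM.loss]
    set d : ℝ := (SBM.clusterDist (SBM.cluster Z₀) (SBM.cluster Zs) : ℝ)
    have h2 : ((n : ℝ) ^ ((m + 3) * s + 1))⁻¹ * Real.exp (-((8 * C + 2) * (n * I) * d)) /
        (n * (n : ℝ) ^ (6 * s + 1)) ^ 2 =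
        Real.exp (-(D * Real.log n + (8 * C + 2) * (n * I) * d)) := by
      have e1 : Real.exp (-(D * Real.log n)) = ((n : ℝ) ^ D)⁻¹ := by
        rw [Real.exp_neg, Real.exp_nat_mul, Real.exp_log hn0]
      have e2 : (n : ℝ) ^ D = n ^ ((m + 3) * s + 1) * (n * (n : ℝ) ^ (6 * s + 1)) ^ 2 := by
        rw [hD]; ring
      rw [neg_add, Real.exp_add, e1, e2, mul_inv]
      ring
    rw [h2] at h1
    have h3 := Real.log_le_log (Real.exp_pos _) h1
    rw [Real.log_exp] at h3
    refine le_trans ?_ h3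
    have h4 : -((D : ℝ) + (8 * C + 2)) * (n : ℝ) ^ 2 * I * (d / n) =
        -((D * (n * I) + (8 * C + 2) * (n * I)) * d) := by
      field_simp
    rw [h4]
    have h5 : Real.log n ≤ n * I * d :=
      hnI.trans (le_mul_of_one_le_right (by positivity) hd)
    have h6 := mul_le_mul_of_nonneg_left h5 (Nat.cast_nonneg (α := ℝ) D)
    linarith
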